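/- Let $d\ge 1$, $l=\lfloor d/2\rfloor+1$, $\gamma\in(-1,1]$, $a\in\mathbb R$ and $\beta:(0,\infty)\to\mathbb R$. Put $\widetilde\beta=\beta-a$, and let $F(u)=\widetilde\beta(|u|)\,u$ for $u\in\mathbb R^d\setminus\{0\}$. Assume that $F$ is of class $C^{l}$ on $\mathbb R^d\setminus\{0\}$ and of class $C^{2l}$ on $\{|u|>1\}$, and that there are constants $C_\alpha,C'_\alpha>0$ with $$|\partial^\alpha F(u)|\le C_\alpha |u|^{\gamma+1-|\alpha|}\quad\text{for } 0<|u|\le 1,\ |\alpha|\le l,$$ $$|\partial^\alpha F(u)|\le C'_\alpha\quad\text{for } |u|> 1,\ 2\le|\alpha|\le 2l.$$ Let $\mathcal FL^1(\mathbb R^d)$ be the space of Fourier transforms $\hat h(u)=\int h(t)e^{-2\pi i t\cdot u}\,dt$ of functions $h\in L^1(\mathbb R^d)$, with norm $\|\hat h\|_{\mathcal FL^1}=\|h\|_{L^1}$, and let $\Phi:\mathbb R^d\to\mathbb C$ belong to the Feichtinger algebra $M^1(\mathbb R^d)=W(\mathcal FL^1,L^1)(\mathbb R^d)$; that is, $g\Phi\in\mathcal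 FL^1(\mathbb R^d)$ for every $g\in C_0^\infty(\mathbb R^d)$, and $\int_{\mathbb R^d}\|\Phi\, g(\cdot-x)\|_{\mathcal FL^1}\,dx<\infty$ for some window $g\in C_0^\infty(\mathbb R^d)$ with $\|g\|_{L^2}=1$. Let $$K(x,y)=\int_{\mathbb R^d}\Phi(u)\,e^{-2\pi i(\beta(|u|)u\cdot y-u\cdot x)}\,du,\qquad Af(x)=\int_{\mathbb R^d}K(x,y)f(y)\,dy ,$$ and let $v(y)=(1+|y|)^{d/(\gamma+1)}$. Then the integral defining $K(x,y)$ converges absolutely for all $x,y\in\mathbb R^d$, and $A$ is bounded from $L^1_v(\mathbb R^d)$ into $L^1(\mathbb R^d)$: there is a constant $C>0$ such that for every $f:\mathbb R^d\to\mathbb C$ with $vf\in L^1(\mathbb R^d)$, the integral defining $Af(x)$ converges absolutely for every $x$, one has $Af(x)=\int\!\!\int e^{-2\pi i(\beta(|u|)u\cdot y-u\cdot x)}\Phi(u)f(y)\,dy\,du$ with an absolutely convergent double integral, $Af\in L^1(\mathbb R^d)$, and $$\int_{\mathbb R^d}|Af(x)|\,dx\le C\int_{\mathbb R^d}|f(y)|\,v(y)\,dy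 .$$ -/

import Mathlib

open MeasureTheory FourierTransform
open scoped ENNReal

noncomputable section

/-- `f` belongs to `𝓕L¹(ℝᵈ)`: it is (almost everywhere equal to) the Fourier transform
`ĥ(u) = ∫ h(t) e^{-2πi t·u} dt` of some `h ∈ L¹(ℝᵈ)`. -/
def MemFourierL1 {d : ℕ} (f : EuclideanSpace ℝ (Fin d) → ℂ) : Prop :=
  ∃ h : EuclideanSpace ℝ (Fin d) → ℂ, Integrable h volume ∧ 𝓕 h =ᵐ[volume] f

/-- The norm `‖f‖_{𝓕L¹} = ‖h‖_{L¹}`, where `ĥ = f`. Such an `h` is unique almost everywhere, so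
the infimum is over a single value; it is `∞` if there is no such `h`. -/
def fourierL1Norm {d : ℕ} (f : EuclideanSpace ℝ (Fin d) → ℂ) : ℝ≥0∞ :=
  ⨅ (h : EuclideanSpace ℝ (Fin d) → ℂ) (_ : Integrable h volume ∧ 𝓕 h =ᵐ[volume] f),
    ∫⁻ t, ‖h t‖ₑ

/-- Test functions, the elements of `C₀^∞(ℝᵈ)`. -/
def IsTestFunction {d : ℕ} (g : EuclideanSpace ℝ (Fin d) → ℂ) : Prop :=
  ContDiff ℝ (⊤ : ℕ∞) g ∧ HasCompactSupport g

/-- The Feichtinger algebra `M¹(ℝᵈ) = W(𝓕L¹, L¹)(ℝᵈ)`: functions that are locally in `𝓕L¹`, and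
for which `x ↦ ‖f T_x g‖_{𝓕L¹}` is in `L¹(ℝᵈ)`, where `g ∈ C₀^∞(ℝᵈ)` is a window function with
`‖g‖_{L²} = 1` and `T_x g(t) = g(t - x)`. (The space does not depend on the window.) -/
def MemM1 {d : ℕ} (f : EuclideanSpace ℝ (Fin d) → ℂ) : Prop :=
  (∀ g : EuclideanSpace ℝ (Fin d) → ℂ, IsTestFunction g → MemFourierL1 (fun t => g t * f t)) ∧
  ∃ g : EuclideanSpace ℝ (Fin d) → ℂ, IsTestFunction g ∧ ∫ t, ‖g t‖ ^ 2 = 1 ∧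
    ∫⁻ x, fourierL1Norm (fun t => f t * g (t - x)) < ∞

/-- The map `u ↦ β(|u|) u` of `ℝᵈ`. Only the values of `β` on `(0, ∞)` matter, since the map
is `0` at the origin for every `β`. -/
def radialMap {d : ℕ} (β : ℝ → ℝ) (u : EuclideanSpace ℝ (Fin d)) : EuclideanSpace ℝ (Fin d) :=
  β ‖u‖ • u

/-- The mixed partial derivative `∂_{s 0} ⋯ ∂_{s (k-1)} F (u)` of order `k`. As `s` ranges over
all `Fin k → Fin d`, this ranges over all `∂^α F (u)` with `|α| = k`. -/
def mixedPartial {d k : ℕ} (s : Fin k → Fin d)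
    (F : EuclideanSpace ℝ (Fin d) → EuclideanSpace ℝ (Fin d)) (u : EuclideanSpace ℝ (Fin d)) :
    EuclideanSpace ℝ (Fin d) :=
  iteratedFDeriv ℝ k F u (fun i => EuclideanSpace.single (s i) (1 : ℝ))

/-- The oscillating factor `e^{-2πi (β(|u|) u·y - u·x)}`. -/
def oscFactor {d : ℕ} (β : ℝ → ℝ) (x y u : EuclideanSpace ℝ (Fin d)) : ℂ :=
  Complex.exp (-2 * Real.pi * Complex.I *
    ((inner ℝ (radialMap β u) y - inner ℝ u x : ℝ) : ℂ))

/-- The kernel `K(x,y) = ∫ Φ(u) e^{-2πi (β(|u|) u·y - u·x)} du`. -/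
def kernelK {d : ℕ} (Φ : EuclideanSpace ℝ (Fin d) → ℂ) (β : ℝ → ℝ)
    (x y : EuclideanSpace ℝ (Fin d)) : ℂ :=
  ∫ u, Φ u * oscFactor β x y u

/-- The integral operator with kernel `K`, `A f(x) = ∫ K(x,y) f(y) dy`. -/
def operatorA {d : ℕ} (Φ : EuclideanSpace ℝ (Fin d) → ℂ) (β : ℝ → ℝ)
    (f : EuclideanSpace ℝ (Fin d) → ℂ) (x : EuclideanSpace ℝ (Fin d)) : ℂ :=
  ∫ y, kernelK Φ β x y * f y

/-- The weight `v(y) = (1 + |y|)^{d/(γ+1)}`. -/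
def weightV {d : ℕ} (γ : ℝ) (y : EuclideanSpace ℝ (Fin d)) : ℝ :=
  (1 + ‖y‖) ^ ((d : ℝ) / (γ + 1))

end

/-!
The phase `β(|u|) u·y` is split as `F(u)·y + a u·y`. The linear part only translates
`x ↦ K(x,y)`, by `a y`, so that `∫ |K(x,y)| dx` is the `L¹` norm of the Fourier transform of
`u ↦ Φ(u) e^{-2πi F(u)·y}`, called `fourierMass` below. By Tonelli's theorem it is enough to bound
this number by `C v(y)`; since `γ ≤ 1`, the bound `C (1 + |y|)^{d/2}` suffices.

With the window `g` of the definition of `M¹`, `∫ |g(u - x)|² dx = 1` gives a continuous partition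
of unity. Since `𝓕L¹` is a Banach algebra under multiplication, the `fourierMass` of
`Φ e^{-2πi F·y}` is at most the `M¹` norm of `Φ` times
`sup_x ‖conj g(· - x) e^{-2πi F·y}‖_{𝓕L¹}` (`MemM1.fourierMass_mul_le`), and what remains is a
local estimate on the oscillating factor, uniform in `x`
(`exists_fourierMass_translate_mul_exp_phase_le`).

The local estimate rests on the embedding of the Sobolev space `Hˡ`, `l > d/2`, into `𝓕L¹`, in a form
that keeps track of scale (`exists_fourierMass_le_of_iteratedFDeriv_le`): a phase whose
derivatives of order at most `l` are bounded by `λ` on a fixed ball gives a factor whose norm is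
`O((1 + λ)^{d/2})`, and `e^{iφ} - 1` gains a further factor `λ / (1 + λ)`
(`exists_fourierMass_mul_exp_sub_one_le`).

* Away from the origin, the first-order Taylor polynomial of the phase at the centre of the window
  is removed: it only contributes a constant of modulus one and a modulation, neither of which changes
  the norm. The derivatives of the remainder are `O(|y|)`, because those of `F` of order at least `2`
  are bounded.
* Near the origin, the cutoff is decomposed into dyadic annuli. After dilation, which again
  preserves the norm, the phase on the annulus `|u| ∼ 2^{-j}` has derivatives
  `O(|y| 2^{-j(γ+1)})`. As `γ > -1` the contributions of `e^{iφ} - 1` decay geometrically in `j`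
  and sum to `O((1 + |y|)^{d/2})`.
-/

/-! ### The `L¹` norm of the Fourier transform -/

section FourierMass

variable {V : Type*} [NormedAddCommGroup V] [InnerProductSpace ℝ V] [FiniteDimensional ℝ V]
  [MeasurableSpace V] [BorelSpace V]

/-- On `L¹ ∩ L²` the Fourier transform of `L²` is given by the Fourier integral. -/
lemma coeFn_fourier_toLp_ae_eq {f : V → ℂ} (hf : Integrable f) (hf2 : MemLp f 2) :
    ((𝓕 (hf2.toLp f) : Lp (α := V) ℂ 2 volume) : V → ℂ) =ᵐ[volume] 𝓕 f := by
  have hcont : Continuous (𝓕 f) :=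
    VectorFourier.fourierIntegral_continuous Real.continuous_fourierChar
      (by exact continuous_inner) hf
  refine ae_eq_of_integral_contDiff_smul_eq ?_ hcont.locallyIntegrable ?_
  · exact (Lp.memLp _).locallyIntegrable (by norm_num)
  intro g hg hgs
  have hgs' : HasCompactSupport (fun x => (g x : ℂ)) := hgs.comp_left Complex.ofReal_zero
  have hg' : ContDiff ℝ (⊤ : ℕ∞) (fun x => (g x : ℂ)) := Complex.ofRealCLM.contDiff.comp hg
  let ψ : SchwartzMap V ℂ := hgs'.toSchwartzMap hg'
  have hψ : ∀ x, ψ x = (g x : ℂ) := fun x => rfl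
  have h1 : (Lp.toTemperedDistribution (𝓕 (hf2.toLp f) : Lp (α := V) ℂ 2 volume)) ψ
      = (Lp.toTemperedDistribution (hf2.toLp f)) (𝓕 ψ) := by
    rw [← Lp.fourier_toTemperedDistribution_eq]
    rfl
  rw [Lp.toTemperedDistribution_apply, Lp.toTemperedDistribution_apply] at h1
  calc ∫ x, g x • (𝓕 (hf2.toLp f) : Lp (α := V) ℂ 2 volume) x
      = ∫ x, ψ x • (𝓕 (hf2.toLp f) : Lp (α := V) ℂ 2 volume) x := by
        simp [hψ]
    _ = ∫ x, (𝓕 ψ) x • (hf2.toLp f) x := h1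
    _ = ∫ x, (𝓕 ψ) x • f x := by
        refine integral_congr_ae ?_
        filter_upwards [hf2.coeFn_toLp] with x hx
        rw [hx]
    _ = ∫ x, ψ x • 𝓕 f x := by
        have := VectorFourier.integral_fourierIntegral_smul_eq_flip (μ := (volume : Measure V))
          (ν := (volume : Measure V)) (L := innerₗ V) (f := ψ) (g := f)
          Real.continuous_fourierChar continuous_inner ψ.integrable hf
        rw [SchwartzMap.fourier_coe]
        exact this.trans (by simp [VectorFourier.fourierIntegral, Real.fourier_eq, real_inner_comm])
    _ = ∫ x, g x • 𝓕 f x := by simp [hψ]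

/-- Plancherel's theorem on `L¹ ∩ L²`, for the Fourier integral. -/
lemma lintegral_enorm_fourier_sq {f : V → ℂ} (hf : Integrable f) (hf2 : MemLp f 2) :
    ∫⁻ t, ‖𝓕 f t‖ₑ ^ 2 = ∫⁻ u, ‖f u‖ₑ ^ 2 := by
  have h2 : eLpNorm (𝓕 f) 2 volume = eLpNorm f 2 volume := by
    rw [← eLpNorm_congr_ae (coeFn_fourier_toLp_ae_eq hf hf2)]
    have h := Lp.norm_fourier_eq (hf2.toLp f)
    rw [Lp.norm_toLp, Lp.norm_def] at h
    rwa [ENNReal.toReal_eq_toReal_iff' (Lp.eLpNorm_ne_top _) hf2.eLpNorm_ne_top] at h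
  rw [eLpNorm_eq_lintegral_rpow_enorm_toReal (by norm_num) (by norm_num),
    eLpNorm_eq_lintegral_rpow_enorm_toReal (by norm_num) (by norm_num)] at h2
  have h3 := ENNReal.rpow_left_injective (x := 1 / (2 : ℝ≥0∞).toReal) (by norm_num) h2
  simpa only [ENNReal.toReal_ofNat, ENNReal.rpow_ofNat] using h3

/-- The `L¹` norm of the Fourier transform; for integrable `f` this is the norm of `f` in `𝓕L¹`. -/
noncomputable def fourierMass (f : V → ℂ) : ℝ≥0∞ := ∫⁻ t, ‖𝓕 f t‖ₑ

lemma continuous_fourier {f : V → ℂ} (hf : Integrable f) : Continuous (𝓕 f) :=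
  VectorFourier.fourierIntegral_continuous Real.continuous_fourierChar
    (by exact continuous_inner) hf

lemma fourierMass_congr_ae {f g : V → ℂ} (h : f =ᵐ[volume] g) : fourierMass f = fourierMass g := by
  unfold fourierMass
  congr with t
  rw [Real.fourier_congr_ae h]

lemma fourierMass_add_le {f g : V → ℂ} (hf : Integrable f) (hg : Integrable g) :
    fourierMass (fun u => f u + g u) ≤ fourierMass f + fourierMass g := by
  unfold fourierMass
  rw [← lintegral_add_left (continuous_fourier hf).measurable.enorm]
  refine lintegral_mono fun t => ?_
  have : 𝓕 (fun u => f u + g u) t = 𝓕 f t + 𝓕 g t := by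
    simp only [Real.fourier_eq, smul_add]
    exact integral_add ((Real.fourierIntegral_convergent_iff t).2 hf)
      ((Real.fourierIntegral_convergent_iff t).2 hg)
  rw [this]
  exact enorm_add_le _ _

lemma fourierMass_sum_le {ι : Type*} (s : Finset ι) {f : ι → V → ℂ}
    (hf : ∀ i ∈ s, Integrable (f i)) :
    fourierMass (fun u => ∑ i ∈ s, f i u) ≤ ∑ i ∈ s, fourierMass (f i) := by
  classical
  induction s using Finset.induction_on with
  | empty => simp [fourierMass, Real.fourier_eq]
  | insert i s hi ih =>
    simp only [Finset.sum_insert hi]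
    refine (fourierMass_add_le (hf i (by simp)) (integrable_finsetSum s
      fun j hj => hf j (by simp [hj]))).trans ?_
    gcongr
    exact ih fun j hj => hf j (by simp [hj])

lemma fourierMass_translate (f : V → ℂ) (p : V) :
    fourierMass (fun u => f (u + p)) = fourierMass f := by
  unfold fourierMass
  congr with t
  have : 𝓕 (fun u => f (u + p)) t = Real.fourierChar (inner ℝ p t) • 𝓕 f t :=
    congrFun (VectorFourier.fourierIntegral_comp_add_right Real.fourierChar volume
      (innerₗ V) f p) t
  rw [this, enorm_eq_iff_norm_eq, Circle.norm_smul]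

lemma fourierMass_modulate (f : V → ℂ) (p : V) :
    fourierMass (fun u => (Real.fourierChar (inner ℝ u p) : ℂ) * f u) = fourierMass f := by
  unfold fourierMass
  have : ∀ t, 𝓕 (fun u => (Real.fourierChar (inner ℝ u p) : ℂ) * f u) t = 𝓕 f (t - p) := by
    intro t
    simp only [Real.fourier_eq, Circle.smul_def, smul_eq_mul]
    congr with v
    rw [← mul_assoc, ← Circle.coe_mul, ← AddChar.map_add_eq_mul, inner_sub_right]
    congr 4
    ring
  simp only [this]
  exact lintegral_sub_right_eq_self (fun t => ‖𝓕 f t‖ₑ) p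

lemma lintegral_comp_smul (g : V → ℝ≥0∞) {c : ℝ} (hc : c ≠ 0) :
    ∫⁻ u, g (c • u) = ENNReal.ofReal |(c ^ Module.finrank ℝ V)⁻¹| * ∫⁻ u, g u := by
  have h := lintegral_map_equiv (μ := (volume : Measure V)) g
    (Homeomorph.smulOfNeZero c hc).toMeasurableEquiv
  have h' : Measure.map (Homeomorph.smulOfNeZero c hc).toMeasurableEquiv (volume : Measure V)
      = ENNReal.ofReal |(c ^ Module.finrank ℝ V)⁻¹| • (volume : Measure V) :=
    Measure.map_addHaar_smul volume hc
  rw [h', lintegral_smul_measure] at h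
  exact h.symm

lemma fourierMass_comp_smul (f : V → ℂ) {c : ℝ} (hc : c ≠ 0) :
    fourierMass (fun u => f (c • u)) = fourierMass f := by
  unfold fourierMass
  have h1 : ∀ t, 𝓕 (fun u => f (c • u)) (c • t)
      = |(c ^ Module.finrank ℝ V)⁻¹| • 𝓕 f t := by
    intro t
    simp only [Real.fourier_eq]
    rw [← Measure.integral_comp_smul volume (fun v => Real.fourierChar (-inner ℝ v t) • f v) c]
    simp only [inner_smul_left, inner_smul_right]
    rfl
  have h2 := lintegral_comp_smul (fun t => ‖𝓕 (fun u => f (c • u)) t‖ₑ) hc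
  have hp : 0 < |(c ^ Module.finrank ℝ V)⁻¹| := abs_pos.2 (inv_ne_zero (pow_ne_zero _ hc))
  simp only [h1, enorm_smul] at h2
  rw [lintegral_const_mul' _ _ enorm_ne_top, Real.enorm_eq_ofReal hp.le] at h2
  exact ((ENNReal.mul_right_inj (by simpa using hp) ENNReal.ofReal_ne_top).1 h2).symm

/-- Multiplication by `𝓕 h` acts on the Fourier side as convolution with `h`. -/
lemma fourierMass_fourier_mul_le {h m : V → ℂ} (hh : Integrable h) (hm : Integrable m) :
    fourierMass (fun u => 𝓕 h u * m u) ≤ (∫⁻ s, ‖h s‖ₑ) * fourierMass m := by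
  have key : ∀ t, 𝓕 (fun u => 𝓕 h u * m u) t = ∫ s, h s * 𝓕 m (s + t) := by
    intro t
    have h1 := VectorFourier.integral_fourierIntegral_smul_eq_flip (μ := (volume : Measure V))
          (ν := (volume : Measure V)) (L := innerₗ V) (f := h)
          (g := fun u => Real.fourierChar (- inner ℝ u t) • m u)
          Real.continuous_fourierChar continuous_inner hh
          ((Real.fourierIntegral_convergent_iff t).2 hm)
    calc 𝓕 (fun u => 𝓕 h u * m u) t
        = ∫ u, 𝓕 h u • (Real.fourierChar (- inner ℝ u t) • m u) := by
          simp only [Real.fourier_eq (fun u => 𝓕 h u * m u) t, Circle.smul_def, smul_eq_mul]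
          congr with u
          ring
      _ = ∫ s, h s • 𝓕 (fun u => Real.fourierChar (- inner ℝ u t) • m u) s := by
          refine h1.trans ?_
          congr with s
          simp [Real.fourier_eq, VectorFourier.fourierIntegral, real_inner_comm]
      _ = _ := by
          congr with s
          simp only [Real.fourier_eq, smul_eq_mul, inner_add_right, neg_add,
            AddChar.map_add_eq_mul, Circle.smul_def, Circle.coe_mul, mul_assoc]
  unfold fourierMass
  calc ∫⁻ t, ‖𝓕 (fun u => 𝓕 h u * m u) t‖ₑ
      ≤ ∫⁻ t, ∫⁻ s, ‖h s‖ₑ * ‖𝓕 m (s + t)‖ₑ := by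
        refine lintegral_mono fun t => ?_
        rw [key]
        refine (enorm_integral_le_lintegral_enorm _).trans (le_of_eq ?_)
        simp
    _ = ∫⁻ s, ∫⁻ t, ‖h s‖ₑ * ‖𝓕 m (s + t)‖ₑ := by
        refine lintegral_lintegral_swap ?_
        refine AEMeasurable.mul hh.1.enorm.comp_snd ?_
        exact ((continuous_fourier hm).comp
          (continuous_snd.add continuous_fst)).enorm.measurable.aemeasurable
    _ = ∫⁻ s, ‖h s‖ₑ * ∫⁻ t, ‖𝓕 m t‖ₑ := by
        congr with s
        rw [lintegral_const_mul _ (f := fun t => ‖𝓕 m (s + t)‖ₑ)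
          (((continuous_fourier hm).comp
          (continuous_const.add continuous_id)).enorm.measurable)]
        rw [lintegral_add_left_eq_self (fun t => ‖𝓕 m t‖ₑ) s]
    _ = _ := lintegral_mul_const'' _ hh.1.enorm

end FourierMass

/-! ### Partitions of unity and the Sobolev embedding -/

section Sobolev

variable {V : Type*} [NormedAddCommGroup V] [InnerProductSpace ℝ V] [FiniteDimensional ℝ V]
  [MeasurableSpace V] [BorelSpace V]

/-- Splitting `f` by a continuous partition of unity made of the translates of `w`. -/
lemma fourierMass_le_lintegral_translates {f w : V → ℂ} (hf : Integrable f) (hw : Continuous w)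
    (hwi : Integrable w) (hw1 : ∫ u, w u = 1) :
    fourierMass f ≤ ∫⁻ x, fourierMass (fun u => f u * w (u - x)) := by
  wlog hfm : StronglyMeasurable f generalizing f
  · have h := this (f := hf.1.mk f) (hf.congr hf.1.ae_eq_mk) hf.1.stronglyMeasurable_mk
    rw [fourierMass_congr_ae hf.1.ae_eq_mk]
    refine h.trans (le_of_eq ?_)
    congr with x
    refine fourierMass_congr_ae ?_
    filter_upwards [hf.1.ae_eq_mk] with u hu
    rw [hu]
  have hprod : Integrable (fun p : V × V => f p.2 * w (p.2 - p.1)) (volume.prod volume) := by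
    have := Integrable.convolution_integrand (ContinuousLinearMap.mul ℝ ℂ) hf hwi.comp_neg
    simpa using this
  have hshift : ∀ u, ∫ x, w (u - x) = 1 := fun u => by
    rw [integral_sub_left_eq_self w volume u, hw1]
  have key : ∀ t, 𝓕 f t = ∫ x, 𝓕 (fun u => f u * w (u - x)) t := by
    intro t
    simp only [Real.fourier_eq]
    rw [integral_integral_swap (f := fun x u => Real.fourierChar (-inner ℝ u t) •
      (f u * w (u - x)))]
    · congr with u
      simp only [Circle.smul_def, smul_eq_mul]
      simp_rw [← mul_assoc]
      rw [integral_const_mul, hshift, mul_one]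
    · refine hprod.bdd_mul (c := 1) (f := fun p : V × V =>
        (Real.fourierChar (-inner ℝ p.2 t) : ℂ)) ?_ ?_
      · refine Continuous.aestronglyMeasurable ?_
        exact continuous_subtype_val.comp (Real.continuous_fourierChar.comp (by fun_prop))
      · exact Filter.Eventually.of_forall fun p => (Circle.norm_coe _).le
  have hmeas : Measurable fun p : V × V => 𝓕 (fun u => f u * w (u - p.2)) p.1 := by
    simp only [Real.fourier_eq]
    refine (StronglyMeasurable.integral_prod_right
      (f := fun (p : V × V) (u : V) => Real.fourierChar (-inner ℝ u p.1) •
        (f u * w (u - p.2))) ?_).measurable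
    simp only [Function.uncurry_def, Circle.smul_def, smul_eq_mul]
    refine StronglyMeasurable.mul ?_ (StronglyMeasurable.mul ?_ ?_)
    · refine Continuous.stronglyMeasurable ?_
      exact continuous_subtype_val.comp (Real.continuous_fourierChar.comp (by fun_prop))
    · exact hfm.comp_measurable measurable_snd
    · exact Continuous.stronglyMeasurable (by fun_prop)
  unfold fourierMass
  calc ∫⁻ t, ‖𝓕 f t‖ₑ ≤ ∫⁻ t, ∫⁻ x, ‖𝓕 (fun u => f u * w (u - x)) t‖ₑ := by
        refine lintegral_mono fun t => ?_
        rw [key]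
        exact enorm_integral_le_lintegral_enorm _
    _ = _ := lintegral_lintegral_swap hmeas.enorm.aemeasurable

/-- Each coordinate derivative of order `l` controls the corresponding moment of `𝓕 f`. -/
lemma lintegral_inner_pow_mul_fourier_sq_le {f : V → ℂ} {l : ℕ} (hf : ContDiff ℝ l f)
    (hfs : HasCompactSupport f) {e : V} (he : ‖e‖ = 1) :
    ∫⁻ t, (‖inner ℝ t e‖ₑ ^ l * ‖𝓕 f t‖ₑ) ^ 2 ≤ ∫⁻ u, ‖iteratedFDeriv ℝ l f u‖ₑ ^ 2 := by
  have hint : ∀ n : ℕ, (n : ℕ∞) ≤ (l : ℕ∞) → Integrable (iteratedFDeriv ℝ n f) := by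
    intro n hn
    exact (hf.continuous_iteratedFDeriv (by exact_mod_cast hn)).integrable_of_hasCompactSupport
      (hfs.iteratedFDeriv n)
  set g : V → ℂ := fun u => iteratedFDeriv ℝ l f u (fun _ => e) with hg
  have hgc : Continuous g := by
    have := hf.continuous_iteratedFDeriv (le_refl (l : WithTop ℕ∞))
    exact (ContinuousMultilinearMap.apply ℝ (fun _ : Fin l => V) ℂ (fun _ => e)).continuous.comp this
  have hgs : HasCompactSupport g :=
    (hfs.iteratedFDeriv l).comp_left (g := fun T : V [×l]→L[ℝ] ℂ => T (fun _ => e)) rfl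
  have hgF : ∀ t, ‖inner ℝ t e‖ₑ ^ l * ‖𝓕 f t‖ₑ ≤ ‖𝓕 g t‖ₑ := by
    intro t
    have h1 := Real.fourier_iteratedFDeriv (N := (l : ℕ∞)) (by exact_mod_cast hf) hint le_rfl
    have h2 := Real.fourier_continuousMultilinearMap_apply (hint l le_rfl) (m := fun _ => e) (v := t)
    have h3 : 𝓕 g t = (-(2 * Real.pi * Complex.I)) ^ l *
        ((-(inner ℝ t e : ℂ)) ^ l * 𝓕 f t) := by
      rw [hg, ← h2, h1]
      simp [show innerSL ℝ t e = inner ℝ t e from rfl]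
    have h4 : ‖inner ℝ t e‖ₑ ^ l * ‖𝓕 f t‖ₑ = ‖(inner ℝ t e : ℂ) ^ l * 𝓕 f t‖ₑ := by
      rw [enorm_mul, enorm_pow]
      congr 2
      exact enorm_eq_iff_norm_eq.2 (Complex.norm_real _).symm
    rw [h3, h4, enorm_le_iff_norm_le]
    simp only [norm_mul, norm_pow, norm_neg, Complex.norm_real, Complex.norm_I, mul_one]
    have : (1:ℝ) ≤ (‖(2:ℂ)‖ * ‖Real.pi‖) ^ l := by
      refine one_le_pow₀ ?_
      rw [Real.norm_of_nonneg Real.pi_pos.le]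
      norm_num
      linarith [Real.pi_gt_three]
    exact le_mul_of_one_le_left (by positivity) this
  calc ∫⁻ t, (‖inner ℝ t e‖ₑ ^ l * ‖𝓕 f t‖ₑ) ^ 2 ≤ ∫⁻ t, ‖𝓕 g t‖ₑ ^ 2 := by
        refine lintegral_mono fun t => ?_
        gcongr
        exact hgF t
    _ = ∫⁻ u, ‖g u‖ₑ ^ 2 :=
        lintegral_enorm_fourier_sq (hgc.integrable_of_hasCompactSupport hgs)
          (hgc.memLp_of_hasCompactSupport hgs)
    _ ≤ _ := by
        refine lintegral_mono fun u => ?_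
        gcongr
        rw [enorm_le_iff_norm_le]
        refine (ContinuousMultilinearMap.le_opNorm _ _).trans (le_of_eq ?_)
        simp [he]

lemma norm_pow_le_sum_inner_pow {V ι : Type*} [NormedAddCommGroup V] [InnerProductSpace ℝ V]
    [Fintype ι] (b : OrthonormalBasis ι ℝ V) {l : ℕ}
    (hl : 0 < l) (t : V) :
    ‖t‖ ^ (2 * l) ≤ (Fintype.card ι : ℝ) ^ l * ∑ i, (‖inner ℝ t (b i)‖ ^ l) ^ 2 := by
  obtain ⟨k, rfl⟩ : ∃ k, l = k + 1 := ⟨l - 1, by omega⟩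
  have h1 : ∑ i, ‖inner ℝ t (b i)‖ ^ 2 = ‖t‖ ^ 2 := b.sum_sq_norm_inner_left t
  rcases isEmpty_or_nonempty ι with hι | hι
  · have h2 : ‖t‖ = 0 := by simpa using h1.symm
    simp [h2]
  have h2 : (0 : ℝ) < (Fintype.card ι : ℝ) := by exact_mod_cast Fintype.card_pos
  have h3 := pow_sum_div_card_le_sum_pow (s := Finset.univ)
    (f := fun i => ‖inner ℝ t (b i)‖ ^ 2) (fun i _ => by positivity) k
  rw [h1, div_le_iff₀ (by simpa using pow_pos h2 k), Finset.card_univ] at h3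
  have h4 : (Fintype.card ι : ℝ) ^ k ≤ (Fintype.card ι : ℝ) ^ (k + 1) :=
    pow_le_pow_right₀ (by exact_mod_cast Fintype.card_pos) (Nat.le_succ k)
  calc ‖t‖ ^ (2 * (k + 1)) = (‖t‖ ^ 2) ^ (k + 1) := pow_mul _ _ _
    _ ≤ _ := h3
    _ ≤ (∑ i, (‖inner ℝ t (b i)‖ ^ 2) ^ (k + 1)) * (Fintype.card ι : ℝ) ^ (k + 1) := by gcongr
    _ = _ := by
      rw [mul_comm]
      congr 2
      ext i
      ring

lemma lintegral_enorm_sq_le_of_tsupport_subset {W : Type*} [NormedAddCommGroup W] {g : V → W}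
    {r A : ℝ} (hg : tsupport g ⊆ Metric.closedBall 0 r) (hA : ∀ u, ‖g u‖ ≤ A) :
    ∫⁻ u, ‖g u‖ₑ ^ 2 ≤ ENNReal.ofReal A ^ 2 * volume (Metric.closedBall (0 : V) r) := by
  rw [← setLIntegral_const, ← lintegral_indicator measurableSet_closedBall]
  refine lintegral_mono fun u => ?_
  by_cases hu : u ∈ Metric.closedBall (0 : V) r
  · rw [Set.indicator_of_mem hu]
    gcongr
    rw [← ofReal_norm]
    exact ENNReal.ofReal_le_ofReal (hA u)
  · have : g u = 0 := image_eq_zero_of_notMem_tsupport fun h => hu (hg h)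
    simp [this]

/-- A scale-invariant form of the embedding of the Sobolev space `Hˡ`, `l > dim V / 2`,
into `𝓕L¹`: a function supported in a fixed ball, bounded by `B`, and with derivatives of
order `l` bounded by `B ρˡ` has `𝓕L¹` norm at most `C B ρ ^ (dim V / 2)`. -/
lemma exists_fourierMass_le_of_iteratedFDeriv_le (V : Type*) [NormedAddCommGroup V]
    [InnerProductSpace ℝ V] [FiniteDimensional ℝ V] [MeasurableSpace V] [BorelSpace V]
    {l : ℕ} (hl : Module.finrank ℝ V < 2 * l) (r : ℝ) :
    ∃ C : ℝ, 0 ≤ C ∧ ∀ (f : V → ℂ) (B ρ : ℝ), 0 ≤ B → 0 < ρ → ContDiff ℝ l f →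
      tsupport f ⊆ Metric.closedBall 0 r → (∀ u, ‖f u‖ ≤ B) →
      (∀ u, ‖iteratedFDeriv ℝ l f u‖ ≤ B * ρ ^ l) →
      fourierMass f ≤ ENNReal.ofReal (C * (B * ρ ^ ((Module.finrank ℝ V : ℝ) / 2))) := by
  set n := Module.finrank ℝ V with hn
  let b : OrthonormalBasis (Fin n) ℝ V := stdOrthonormalBasis ℝ V
  set I : ℝ≥0∞ := ∫⁻ t : V, ENNReal.ofReal ((1 + ‖t‖) ^ (-(2 * l : ℝ))) with hI
  have hIfin : I < ∞ := finite_integral_one_add_norm (by rw [← hn]; exact_mod_cast hl)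
  set v : ℝ≥0∞ := volume (Metric.closedBall (0 : V) r) with hv
  have hvfin : v < ∞ := measure_closedBall_lt_top
  set M : ℝ≥0∞ := 2 ^ (2 * l) * (1 + n ^ l * n) * v with hM
  have hMfin : M < ∞ := by
    refine ENNReal.mul_lt_top (ENNReal.mul_lt_top (by simp) ?_) hvfin
    simp [ENNReal.mul_lt_top_iff]
  refine ⟨((I ^ (1/2 : ℝ)) * (M ^ (1/2 : ℝ))).toReal, ENNReal.toReal_nonneg, ?_⟩
  intro f B ρ hB hρ hf hfs hfB hfD
  have hcs : HasCompactSupport f :=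
    (isCompact_closedBall (0 : V) r).of_isClosed_subset (isClosed_tsupport f) hfs
  have hfi : Integrable f := hf.continuous.integrable_of_hasCompactSupport hcs
  have hf2 : MemLp f 2 := hf.continuous.memLp_of_hasCompactSupport hcs
  have hc : Continuous (𝓕 f) := continuous_fourier hfi
  have h0 : ∫⁻ t, ‖𝓕 f t‖ₑ ^ 2 ≤ ENNReal.ofReal B ^ 2 * v := by
    rw [lintegral_enorm_fourier_sq hfi hf2]
    exact lintegral_enorm_sq_le_of_tsupport_subset hfs hfB
  have h1 : ∀ i, ∫⁻ t, (‖inner ℝ t (b i)‖ₑ ^ l * ‖𝓕 f t‖ₑ) ^ 2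
      ≤ ENNReal.ofReal (B * ρ ^ l) ^ 2 * v := fun i =>
    (lintegral_inner_pow_mul_fourier_sq_le hf hcs (b.norm_eq_one i)).trans
      (lintegral_enorm_sq_le_of_tsupport_subset
        ((tsupport_iteratedFDeriv_subset l).trans hfs) hfD)
  have hpt : ∀ t : V, (ENNReal.ofReal ((1 + ‖ρ⁻¹ • t‖) ^ l) * ‖𝓕 f t‖ₑ) ^ 2 ≤
      2 ^ (2 * l) * (‖𝓕 f t‖ₑ ^ 2 + ENNReal.ofReal (ρ⁻¹ ^ l) ^ 2 *
        (n ^ l * ∑ i, (‖inner ℝ t (b i)‖ₑ ^ l * ‖𝓕 f t‖ₑ) ^ 2)) := by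
    intro t
    have hF := norm_nonneg (𝓕 f t)
    have h3 : ‖ρ⁻¹ • t‖ = ρ⁻¹ * ‖t‖ := by
      rw [norm_smul, Real.norm_of_nonneg (by positivity)]
    have h4 : (1 + ρ⁻¹ * ‖t‖) ^ (2 * l) ≤ 2 ^ (2 * l) * (1 + (ρ⁻¹ * ‖t‖) ^ (2 * l)) := by
      have h5 := add_pow_le (zero_le_one (α := ℝ)) (by positivity : 0 ≤ ρ⁻¹ * ‖t‖) (2 * l)
      rw [one_pow] at h5
      refine h5.trans ?_
      gcongr
      · norm_num
      · omega
    have h5 := norm_pow_le_sum_inner_pow b (by omega : 0 < l) t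
    rw [Fintype.card_fin] at h5
    have h6 : ((1 + ‖ρ⁻¹ • t‖) ^ l * ‖𝓕 f t‖) ^ 2 ≤
        2 ^ (2 * l) * (‖𝓕 f t‖ ^ 2 + (ρ⁻¹ ^ l) ^ 2 *
          (n ^ l * ∑ i, (‖inner ℝ t (b i)‖ ^ l * ‖𝓕 f t‖) ^ 2)) := by
      calc ((1 + ‖ρ⁻¹ • t‖) ^ l * ‖𝓕 f t‖) ^ 2
          = (1 + ρ⁻¹ * ‖t‖) ^ (2 * l) * ‖𝓕 f t‖ ^ 2 := by rw [h3]; ring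
        _ ≤ 2 ^ (2 * l) * (1 + (ρ⁻¹ * ‖t‖) ^ (2 * l)) * ‖𝓕 f t‖ ^ 2 := by gcongr
        _ = 2 ^ (2 * l) * (‖𝓕 f t‖ ^ 2 + (ρ⁻¹ ^ l) ^ 2 * (‖t‖ ^ (2 * l) * ‖𝓕 f t‖ ^ 2)) := by
          ring
        _ ≤ 2 ^ (2 * l) * (‖𝓕 f t‖ ^ 2 + (ρ⁻¹ ^ l) ^ 2 *
          ((n ^ l * ∑ i, (‖inner ℝ t (b i)‖ ^ l) ^ 2) * ‖𝓕 f t‖ ^ 2)) := by gcongr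
        _ = _ := by
          simp only [mul_pow _ ‖𝓕 f t‖, ← Finset.sum_mul]
          ring
    have h7 := ENNReal.ofReal_le_ofReal h6
    rw [ENNReal.ofReal_pow (by positivity), ENNReal.ofReal_mul (by positivity),
      ENNReal.ofReal_mul (by positivity), ENNReal.ofReal_add (by positivity) (by positivity),
      ENNReal.ofReal_mul (by positivity), ENNReal.ofReal_mul (by positivity),
      ENNReal.ofReal_sum_of_nonneg (fun i _ => by positivity)] at h7
    simp only [ENNReal.ofReal_pow (norm_nonneg _), ENNReal.ofReal_pow (inv_nonneg.2 hρ.le),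
      ENNReal.ofReal_pow (mul_nonneg (pow_nonneg (norm_nonneg _) l) hF),
      ENNReal.ofReal_mul (pow_nonneg (norm_nonneg _) l), ofReal_norm, ENNReal.ofReal_natCast,
      ENNReal.ofReal_pow (Nat.cast_nonneg n), ENNReal.ofReal_pow (zero_le_two (α := ℝ)),
      ENNReal.ofReal_pow (pow_nonneg (inv_nonneg.2 hρ.le) l), ENNReal.ofReal_ofNat] at h7 ⊢
    exact h7
  have h2 : ∫⁻ t, (ENNReal.ofReal ((1 + ‖ρ⁻¹ • t‖) ^ l) * ‖𝓕 f t‖ₑ) ^ 2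
      ≤ ENNReal.ofReal B ^ 2 * M := by
    calc _ ≤ ∫⁻ t, 2 ^ (2 * l) * (‖𝓕 f t‖ₑ ^ 2 + ENNReal.ofReal (ρ⁻¹ ^ l) ^ 2 *
        (n ^ l * ∑ i, (‖inner ℝ t (b i)‖ₑ ^ l * ‖𝓕 f t‖ₑ) ^ 2)) := lintegral_mono hpt
      _ = 2 ^ (2 * l) * ((∫⁻ t, ‖𝓕 f t‖ₑ ^ 2) + ENNReal.ofReal (ρ⁻¹ ^ l) ^ 2 *
        (n ^ l * ∑ i, ∫⁻ t, (‖inner ℝ t (b i)‖ₑ ^ l * ‖𝓕 f t‖ₑ) ^ 2)) := by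
          have hm : ∀ i, Measurable fun t => (‖inner ℝ t (b i)‖ₑ ^ l * ‖𝓕 f t‖ₑ) ^ 2 := fun i =>
            (((continuous_id.inner continuous_const).measurable.enorm.pow_const l).mul
              hc.measurable.enorm).pow_const 2
          rw [lintegral_const_mul' _ _ (by simp), lintegral_add_left (hc.measurable.enorm.pow_const 2),
            lintegral_const_mul' _ _ (by simp), lintegral_const_mul' _ _ (by simp),
            lintegral_finsetSum _ fun i _ => hm i]
      _ ≤ 2 ^ (2 * l) * (ENNReal.ofReal B ^ 2 * v + ENNReal.ofReal (ρ⁻¹ ^ l) ^ 2 *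
        (n ^ l * ∑ i : Fin n, ENNReal.ofReal (B * ρ ^ l) ^ 2 * v)) := by
          gcongr with i
          exact h1 i
      _ = _ := by
          have h3 : ENNReal.ofReal (ρ⁻¹ ^ l) * ENNReal.ofReal (B * ρ ^ l) = ENNReal.ofReal B := by
            rw [← ENNReal.ofReal_mul (by positivity)]
            congr 1
            rw [inv_pow]
            field_simp
          rw [← h3, hM]
          simp only [Finset.sum_const, Finset.card_univ, Fintype.card_fin, nsmul_eq_mul]
          generalize ENNReal.ofReal (ρ⁻¹ ^ l) = x
          generalize ENNReal.ofReal (B * ρ ^ l) = y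
          ring
  have h3 : ∫⁻ t : V, ENNReal.ofReal ((1 + ‖ρ⁻¹ • t‖) ^ (-(l : ℝ))) ^ 2
      = ENNReal.ofReal (ρ ^ n) * I := by
    rw [lintegral_comp_smul (fun t : V => ENNReal.ofReal ((1 + ‖t‖) ^ (-(l : ℝ))) ^ 2)
      (inv_ne_zero hρ.ne')]
    congr 1
    · rw [← hn, inv_pow, inv_inv, abs_of_pos (by positivity)]
    · congr with t
      rw [← ENNReal.ofReal_pow (by positivity), ← Real.rpow_natCast, ← Real.rpow_mul (by positivity)]
      congr 2
      push_cast
      ring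
  -- Cauchy-Schwarz with the weight `(1 + ‖t / ρ‖)ˡ`, whose inverse is square integrable
  calc fourierMass f = ∫⁻ t, ENNReal.ofReal ((1 + ‖ρ⁻¹ • t‖) ^ (-(l : ℝ))) *
        (ENNReal.ofReal ((1 + ‖ρ⁻¹ • t‖) ^ l) * ‖𝓕 f t‖ₑ) := by
        unfold fourierMass
        congr with t
        rw [← mul_assoc, ← ENNReal.ofReal_mul (by positivity), Real.rpow_neg (by positivity),
          Real.rpow_natCast, inv_mul_cancel₀ (by positivity)]
        simp
    _ ≤ (∫⁻ t : V, ENNReal.ofReal ((1 + ‖ρ⁻¹ • t‖) ^ (-(l : ℝ))) ^ 2) ^ (1 / 2 : ℝ) *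
        (∫⁻ t, (ENNReal.ofReal ((1 + ‖ρ⁻¹ • t‖) ^ l) * ‖𝓕 f t‖ₑ) ^ 2) ^ (1 / 2 : ℝ) := by
        have := ENNReal.lintegral_mul_le_Lp_mul_Lq (volume : Measure V)
          Real.HolderConjugate.two_two
          (f := fun t => ENNReal.ofReal ((1 + ‖ρ⁻¹ • t‖) ^ (-(l : ℝ))))
          (g := fun t => ENNReal.ofReal ((1 + ‖ρ⁻¹ • t‖) ^ l) * ‖𝓕 f t‖ₑ) ?_ ?_
        · simpa only [ENNReal.rpow_ofNat, Pi.mul_apply] using this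
        · exact (Measurable.ennreal_ofReal (by fun_prop)).aemeasurable
        · exact ((Measurable.ennreal_ofReal (by fun_prop)).mul hc.measurable.enorm).aemeasurable
    _ ≤ (ENNReal.ofReal (ρ ^ n) * I) ^ (1 / 2 : ℝ) * (ENNReal.ofReal B ^ 2 * M) ^ (1 / 2 : ℝ) := by
        rw [h3]
        gcongr
    _ = _ := by
        rw [ENNReal.mul_rpow_of_nonneg _ _ (by norm_num), ENNReal.mul_rpow_of_nonneg _ _ (by norm_num),
          ENNReal.ofReal_mul ENNReal.toReal_nonneg, ENNReal.ofReal_toReal, ENNReal.ofReal_mul hB,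
          ENNReal.ofReal_rpow_of_nonneg (by positivity) (by norm_num), ← ENNReal.rpow_natCast,
          ← ENNReal.rpow_mul, ← Real.rpow_natCast, ← Real.rpow_mul hρ.le]
        · norm_num
          rw [div_eq_mul_inv]
          ring_nf
        · exact ENNReal.mul_ne_top (ENNReal.rpow_ne_top_of_nonneg (by norm_num) hIfin.ne)
            (ENNReal.rpow_ne_top_of_nonneg (by norm_num) hMfin.ne)

end Sobolev

/-! ### Oscillating factors with a smooth phase -/

section Oscillation

variable {V : Type*} [NormedAddCommGroup V] [InnerProductSpace ℝ V]

lemma norm_iteratedFDeriv_exp_I_mul (k : ℕ) (s : ℝ) :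
    ‖iteratedFDeriv ℝ k (fun x : ℝ => Complex.exp (Complex.I * x)) s‖ = 1 := by
  have h : ∀ k : ℕ, iteratedDeriv k (fun x : ℝ => Complex.exp (Complex.I * x)) =
      fun x : ℝ => Complex.I ^ k * Complex.exp (Complex.I * x) := by
    intro k
    induction k with
    | zero => simp
    | succ k ih =>
      rw [iteratedDeriv_succ, ih]
      ext x
      have h1 : HasDerivAt (fun x : ℝ => Complex.exp (Complex.I * x))
          (Complex.exp (Complex.I * x) * Complex.I) x := by
        have := ((Complex.ofRealCLM.hasDerivAt (x := x)).const_mul Complex.I).cexp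
        simpa using this
      rw [(h1.const_mul (Complex.I ^ k)).deriv]
      ring
  rw [norm_iteratedFDeriv_eq_norm_iteratedDeriv, h]
  simp [Complex.norm_exp]

/-- The derivatives of `e^{iφ} - 1`, when those of `φ` are at most `lam`. The factor
`lam / (1 + lam)` makes the bound small together with `lam`. -/
lemma norm_iteratedFDerivWithin_exp_sub_one_le {U : Set V} (hU : IsOpen U) {φ : V → ℝ} {l : ℕ}
    (hφ : ContDiffOn ℝ l φ U) {u : V} (hu : u ∈ U) {lam : ℝ} (hlam : 0 ≤ lam)
    (h : ∀ k ≤ l, ‖iteratedFDeriv ℝ k φ u‖ ≤ lam) {k : ℕ} (hk : k ≤ l) :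
    ‖iteratedFDerivWithin ℝ k (fun u => Complex.exp (Complex.I * φ u) - 1) U u‖ ≤
      4 * k.factorial * (lam / (1 + lam)) * (1 + lam) ^ k := by
  set μ := lam / (1 + lam) with hμ
  have h1 : 0 < 1 + lam := by linarith
  have hμ0 : 0 ≤ μ := by positivity
  have hμ1 : μ ≤ 1 := by rw [hμ, div_le_one h1]; linarith
  rcases Nat.eq_zero_or_pos k with rfl | hk0
  · have h0 := h 0 (Nat.zero_le _)
    rw [norm_iteratedFDeriv_zero, Real.norm_eq_abs] at h0
    rw [norm_iteratedFDerivWithin_zero]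
    have ha : ‖Complex.exp (Complex.I * φ u) - 1‖ ≤ lam := by
      refine (Real.norm_exp_I_mul_ofReal_sub_one_le).trans ?_
      simpa using h0
    have hb : ‖Complex.exp (Complex.I * φ u) - 1‖ ≤ 2 := by
      refine (norm_sub_le _ _).trans ?_
      simp [Complex.norm_exp]
      norm_num
    simp only [Nat.factorial_zero, Nat.cast_one, mul_one, pow_zero]
    rw [hμ, ← mul_div_assoc, le_div_iff₀ h1]
    nlinarith [norm_nonneg (Complex.exp (Complex.I * φ u) - 1)]
  · have hsub : iteratedFDerivWithin ℝ k (fun u => Complex.exp (Complex.I * φ u) - 1) U u =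
        iteratedFDerivWithin ℝ k (fun u => Complex.exp (Complex.I * φ u)) U u := by
      have h3 : ContDiffWithinAt ℝ k (fun u => Complex.exp (Complex.I * φ u)) U u :=
        ((contDiffOn_const.mul (Complex.ofRealCLM.contDiff.comp_contDiffOn hφ)).cexp u hu).of_le
          (by exact_mod_cast hk)
      have h4 := iteratedFDerivWithin_sub_apply (i := k) h3
        (contDiffWithinAt_const (c := (1 : ℂ))) hU.uniqueDiffOn hu
      rw [iteratedFDerivWithin_const_of_ne hk0.ne', Pi.zero_apply, sub_zero] at h4
      exact h4
    rw [hsub]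
    -- distributing the small factor `μ` evenly over the `k` derivatives of the chain rule lets
    -- a single factor `μ` survive in the final bound
    have hD : ∀ i, 1 ≤ i → i ≤ k →
        ‖iteratedFDerivWithin ℝ i φ U u‖ ≤ ((1 + lam) * μ ^ (1 / (k : ℝ))) ^ i := by
      intro i hi hik
      rw [iteratedFDerivWithin_of_isOpen i hU hu]
      refine (h i (hik.trans hk)).trans ?_
      rw [mul_pow, ← Real.rpow_natCast (μ ^ (1 / (k : ℝ))), ← Real.rpow_mul hμ0]
      have ha : μ ≤ μ ^ (1 / (k : ℝ) * i) := by
        have h2 : 1 / (k : ℝ) * i ≤ 1 := by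
          rw [one_div, inv_mul_le_iff₀ (by exact_mod_cast hk0)]
          simpa using hik
        have h3 : 0 < 1 / (k : ℝ) * i := by positivity
        rcases hμ0.eq_or_lt with h4 | h4
        · rw [← h4, Real.zero_rpow h3.ne']
        · simpa using Real.rpow_le_rpow_of_exponent_ge h4 hμ1 h2
      have hb : 1 + lam ≤ (1 + lam) ^ i := le_self_pow₀ (by linarith) (by omega)
      calc lam = (1 + lam) * μ := by rw [hμ]; field_simp
        _ ≤ _ := by gcongr
    have h2 := norm_iteratedFDerivWithin_comp_le (N := (l : ℕ)) (t := Set.univ) (C := 1)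
      (g := fun x : ℝ => Complex.exp (Complex.I * x)) (f := φ) (n := k) (by
        refine ContDiff.contDiffOn ?_
        exact (contDiff_const.mul Complex.ofRealCLM.contDiff).cexp) hφ (by exact_mod_cast hk)
        uniqueDiffOn_univ hU.uniqueDiffOn (Set.mapsTo_univ _ _) hu (by
          intro i hi
          rw [iteratedFDerivWithin_univ, norm_iteratedFDeriv_exp_I_mul]) hD
    refine h2.trans ?_
    rw [mul_pow, ← Real.rpow_natCast (μ ^ (1 / (k : ℝ))), ← Real.rpow_mul hμ0,
      one_div, inv_mul_cancel₀ (by positivity), Real.rpow_one]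
    have : 0 ≤ k.factorial * ((1 + lam) ^ k * μ) := by positivity
    linarith

variable [FiniteDimensional ℝ V] [MeasurableSpace V] [BorelSpace V]

/-- The `𝓕L¹` norm of `χ (e^{iφ} - 1)` when `φ` and its derivatives of order at most
`l > dim V / 2` are bounded by `lam` on the support of `χ`. The exponent `dim V / 2` comes from
balancing the derivatives of order `0` and `l` at the frequency `1 + lam`. -/
lemma exists_fourierMass_mul_exp_sub_one_le {l : ℕ} (hl : Module.finrank ℝ V < 2 * l) {χ : V → ℂ}
    (hχ : ContDiff ℝ l χ) (hχs : HasCompactSupport χ) :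
    ∃ C : ℝ, 0 ≤ C ∧ ∀ (U : Set V) (φ : V → ℝ) (lam : ℝ), IsOpen U → tsupport χ ⊆ U →
      ContDiffOn ℝ l φ U → 0 ≤ lam →
      (∀ k ≤ l, ∀ u ∈ tsupport χ, ‖iteratedFDeriv ℝ k φ u‖ ≤ lam) →
      fourierMass (fun u => χ u * (Complex.exp (Complex.I * φ u) - 1)) ≤
        ENNReal.ofReal (C * (lam / (1 + lam) * (1 + lam) ^ ((Module.finrank ℝ V : ℝ) / 2))) := by
  obtain ⟨r, hr⟩ := hχs.isBounded.subset_closedBall (0 : V)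
  obtain ⟨C, hC, hCf⟩ := exists_fourierMass_le_of_iteratedFDeriv_le V hl r
  have hbd : ∃ A : ℝ, 0 ≤ A ∧ ∀ k ≤ l, ∀ u, ‖iteratedFDeriv ℝ k χ u‖ ≤ A := by
    have : ∀ k : ℕ, ∃ A : ℝ, k ≤ l → ∀ u, ‖iteratedFDeriv ℝ k χ u‖ ≤ A := by
      intro k
      by_cases hk : k ≤ l
      · obtain ⟨A, hA⟩ := (hχs.iteratedFDeriv k).exists_bound_of_continuous
          (hχ.continuous_iteratedFDeriv (by exact_mod_cast hk))
        exact ⟨A, fun _ => hA⟩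
      · exact ⟨0, fun h => absurd h hk⟩
    choose A hA using this
    refine ⟨∑ k ∈ Finset.range (l + 1), |A k|, by positivity, fun k hk u => ?_⟩
    refine (hA k hk u).trans ((le_abs_self _).trans ?_)
    exact Finset.single_le_sum (f := fun k => |A k|) (fun i _ => abs_nonneg _)
      (Finset.mem_range.2 (by omega))
  obtain ⟨A, hA0, hA⟩ := hbd
  set M : ℝ := 2 ^ l * A * (4 * l.factorial) with hM
  refine ⟨C * M, by positivity, ?_⟩
  intro U φ lam hU hχU hφ hlam hφb
  set f : V → ℂ := fun u => χ u * (Complex.exp (Complex.I * φ u) - 1) with hf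
  set μ := lam / (1 + lam) with hμ
  have h1 : 1 ≤ 1 + lam := by linarith
  have hμ0 : 0 ≤ μ := by positivity
  have hfU : tsupport f ⊆ tsupport χ := closure_mono fun u hu => left_ne_zero_of_mul hu
  have he : ContDiffOn ℝ l (fun u => Complex.exp (Complex.I * φ u) - 1) U :=
    ((contDiffOn_const.mul (Complex.ofRealCLM.contDiff.comp_contDiffOn hφ)).cexp).sub contDiffOn_const
  have hfc : ContDiff ℝ l f := by
    rw [contDiff_iff_contDiffAt]
    intro u
    by_cases hu : u ∈ tsupport χ
    · exact ((hχ.contDiffOn.mul he).contDiffAt (hU.mem_nhds (hχU hu)))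
    · have : f =ᶠ[nhds u] fun _ => 0 := by
        have := notMem_tsupport_iff_eventuallyEq.1 (fun h => hu (hfU h))
        exact this
      exact contDiffAt_const.congr_of_eventuallyEq this
  have hD : ∀ k ≤ l, ∀ u, ‖iteratedFDeriv ℝ k f u‖ ≤ M * μ * (1 + lam) ^ k := by
    intro k hk u
    by_cases hu : u ∈ tsupport χ
    · have huU := hχU hu
      rw [← iteratedFDerivWithin_of_isOpen k hU huU]
      refine (norm_iteratedFDerivWithin_mul_le (N := (l : ℕ)) hχ.contDiffOn he hU.uniqueDiffOn huU
        (by exact_mod_cast hk)).trans ?_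
      calc _ ≤ ∑ i ∈ Finset.range (k + 1), (k.choose i : ℝ) *
            (A * (4 * l.factorial) * μ * (1 + lam) ^ k) := by
            refine Finset.sum_le_sum fun i hi => ?_
            have hik : i ≤ k := by simpa [Nat.lt_succ_iff] using hi
            rw [mul_assoc]
            refine mul_le_mul_of_nonneg_left ?_ (Nat.cast_nonneg _)
            have ha := hA i (hik.trans hk) u
            rw [← iteratedFDerivWithin_of_isOpen i hU huU] at ha
            have hb := norm_iteratedFDerivWithin_exp_sub_one_le hU hφ huU hlam
              (fun j hj => hφb j hj u hu) (show k - i ≤ l by omega)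
            have hc : 4 * ((k - i).factorial : ℝ) * μ * (1 + lam) ^ (k - i) ≤
                4 * (l.factorial : ℝ) * μ * (1 + lam) ^ k := by
              gcongr
              · omega
              · omega
            calc _ ≤ A * (4 * (l.factorial : ℝ) * μ * (1 + lam) ^ k) :=
                  mul_le_mul ha (hb.trans hc) (norm_nonneg _) hA0
              _ = _ := by ring
        _ = 2 ^ k * (A * (4 * l.factorial) * μ * (1 + lam) ^ k) := by
            rw [← Finset.sum_mul]
            congr 1
            exact_mod_cast Nat.sum_range_choose k
        _ ≤ 2 ^ l * (A * (4 * l.factorial) * μ * (1 + lam) ^ k) := by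
            gcongr
            norm_num
        _ = _ := by rw [hM]; ring
    · have : iteratedFDeriv ℝ k f u = 0 := by
        refine image_eq_zero_of_notMem_tsupport fun h => hu ?_
        exact hfU (tsupport_iteratedFDeriv_subset k h)
      rw [this, norm_zero]
      positivity
  have := hCf f (M * μ) (1 + lam) (by positivity) (by linarith) hfc
    (hfU.trans hr) (fun u => by simpa using hD 0 (Nat.zero_le _) u) (fun u => hD l le_rfl u)
  refine this.trans (le_of_eq ?_)
  congr 1
  ring

end Oscillation

/-! ### Dyadic decomposition near the origin -/

section Near

variable {V : Type*} [NormedAddCommGroup V] [InnerProductSpace ℝ V]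

/-- The phase function of the operator, `u ↦ -2π F(u)·y`. -/
noncomputable def phase (F : V → V) (y u : V) : ℝ := -2 * Real.pi * inner ℝ (F u) y

/-- The linear form whose composition with `F` is the phase. -/
noncomputable def phaseCLM (y : V) : V →L[ℝ] ℝ := (-2 * Real.pi) • innerSL ℝ y

lemma phase_eq (F : V → V) (y u : V) : phase F y u = phaseCLM y (F u) := by
  simp [phase, phaseCLM, real_inner_comm]

lemma norm_phaseCLM_le (y : V) : ‖phaseCLM y‖ ≤ 7 * ‖y‖ := by
  rw [phaseCLM, norm_smul, innerSL_apply_norm, norm_mul, norm_neg, Real.norm_two,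
    Real.norm_of_nonneg Real.pi_pos.le]
  gcongr
  linarith [Real.pi_lt_d2]

lemma norm_exp_I_phase (F : V → V) (y u : V) :
    ‖Complex.exp (Complex.I * phase F y u)‖ = 1 := by
  simp [Complex.norm_exp]

lemma norm_exp_I_phase_sub_one_le (F : V → V) (y u : V) :
    ‖Complex.exp (Complex.I * phase F y u) - 1‖ ≤ 2 := by
  refine (norm_sub_le _ _).trans ?_
  rw [norm_exp_I_phase, norm_one]
  norm_num

lemma norm_iteratedFDeriv_comp_smul_le {W : Type*} [NormedAddCommGroup W] [NormedSpace ℝ W]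
    (f : V → W) {c : ℝ} (hc : 0 < c) (k : ℕ) (w : V) :
    ‖iteratedFDeriv ℝ k (fun w => f (c • w)) w‖ ≤ c ^ k * ‖iteratedFDeriv ℝ k f (c • w)‖ := by
  let L : V ≃L[ℝ] V := ContinuousLinearEquiv.smulLeft (Units.mk0 c hc.ne')
  have h := L.iteratedFDerivWithin_comp_right f uniqueDiffOn_univ (x := w) (Set.mem_univ _) k
  simp only [Set.preimage_univ, iteratedFDerivWithin_univ] at h
  have hL : ‖(L : V →L[ℝ] V)‖ ≤ c := by
    refine ContinuousLinearMap.opNorm_le_bound _ hc.le fun v => ?_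
    change ‖c • v‖ ≤ c * ‖v‖
    rw [norm_smul, Real.norm_of_nonneg hc.le]
  change ‖iteratedFDeriv ℝ k (f ∘ L) w‖ ≤ c ^ k * ‖iteratedFDeriv ℝ k f (L w)‖
  rw [h, mul_comm]
  refine (ContinuousMultilinearMap.norm_compContinuousLinearMap_le _ _).trans ?_
  rw [Finset.prod_const, Finset.card_univ, Fintype.card_fin]
  gcongr

/-- The derivatives of a phase that is nearly homogeneous of degree `γ + 1`, on a dyadic annulus
rescaled to unit size. -/
lemma norm_iteratedFDeriv_phase_comp_smul_le {F : V → V} {l : ℕ}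
    (hF : ContDiffOn ℝ l F {u | u ≠ 0}) {γ C M : ℝ} (hγ : γ ≤ 1) (hC : 0 ≤ C)
    (hFb : ∀ k ≤ l, ∀ u, u ≠ 0 → ‖u‖ ≤ M →
      ‖iteratedFDeriv ℝ k F u‖ ≤ C * ‖u‖ ^ (γ + 1 - (k : ℝ)))
    (y : V) {c : ℝ} (hc : 0 < c) (hc1 : c ≤ 1) {w : V} (hw : 1 ≤ ‖w‖) (hwM : ‖w‖ ≤ M)
    {k : ℕ} (hk : k ≤ l) :
    ‖iteratedFDeriv ℝ k (fun w => phase F y (c • w)) w‖ ≤ 7 * C * M ^ 2 * ‖y‖ * c ^ (γ + 1) := by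
  have hw0 : w ≠ 0 := norm_pos_iff.1 (by linarith)
  have hcw : c • w ≠ 0 := smul_ne_zero hc.ne' hw0
  have hncw : ‖c • w‖ = c * ‖w‖ := by rw [norm_smul, Real.norm_of_nonneg hc.le]
  have hat : ContDiffAt ℝ l F (c • w) :=
    hF.contDiffAt (isOpen_ne.mem_nhds hcw)
  have h1 : ‖iteratedFDeriv ℝ k (fun w => phase F y (c • w)) w‖
      ≤ c ^ k * ‖iteratedFDeriv ℝ k (phase F y) (c • w)‖ := by
    exact norm_iteratedFDeriv_comp_smul_le (phase F y) hc k w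
  have h2 : ‖iteratedFDeriv ℝ k (phase F y) (c • w)‖ ≤
      7 * ‖y‖ * (C * (c * ‖w‖) ^ (γ + 1 - (k : ℝ))) := by
    have h3 : phase F y = phaseCLM y ∘ F := funext fun u => phase_eq F y u
    rw [h3]
    refine ((phaseCLM y).norm_iteratedFDeriv_comp_left hat (by exact_mod_cast hk)).trans ?_
    have h4 := hFb k hk (c • w) hcw (by
      rw [hncw]
      exact (mul_le_of_le_one_left (norm_nonneg _) hc1).trans hwM)
    rw [hncw] at h4
    exact mul_le_mul (norm_phaseCLM_le y) h4 (norm_nonneg _) (by positivity)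
  have h3 : ‖w‖ ^ (γ + 1 - (k : ℝ)) ≤ M ^ 2 := by
    calc ‖w‖ ^ (γ + 1 - (k : ℝ)) ≤ ‖w‖ ^ (2 : ℝ) := by
          refine Real.rpow_le_rpow_of_exponent_le hw ?_
          have : (0 : ℝ) ≤ k := Nat.cast_nonneg k
          linarith
      _ = ‖w‖ ^ 2 := Real.rpow_two _
      _ ≤ M ^ 2 := by gcongr
  calc _ ≤ c ^ k * (7 * ‖y‖ * (C * (c * ‖w‖) ^ (γ + 1 - (k : ℝ)))) :=
        h1.trans (by gcongr)
    _ = 7 * C * ‖w‖ ^ (γ + 1 - (k : ℝ)) * ‖y‖ * c ^ (γ + 1) := by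
        rw [Real.mul_rpow hc.le (norm_nonneg _), Real.rpow_sub hc, Real.rpow_natCast]
        field_simp
    _ ≤ _ := by gcongr

variable [FiniteDimensional ℝ V]

/-- The dyadic piece of a cutoff function `θ`, which lives on an annulus. -/
noncomputable def dyadicPiece (θ : ContDiffBump (0 : V)) (w : V) : ℂ := (θ w : ℂ) - θ ((2 : ℝ) • w)

lemma contDiff_ofReal_bump (θ : ContDiffBump (0 : V)) (l : ℕ) :
    ContDiff ℝ l (fun u => (θ u : ℂ)) :=
  Complex.ofRealCLM.contDiff.comp θ.contDiff

lemma hasCompactSupport_ofReal_bump (θ : ContDiffBump (0 : V)) :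
    HasCompactSupport (fun u => (θ u : ℂ)) :=
  θ.hasCompactSupport.comp_left Complex.ofReal_zero

lemma contDiff_dyadicPiece (θ : ContDiffBump (0 : V)) (l : ℕ) : ContDiff ℝ l (dyadicPiece θ) :=
  (contDiff_ofReal_bump θ l).sub ((contDiff_ofReal_bump θ l).comp (contDiff_const_smul _))

lemma tsupport_dyadicPiece_subset (θ : ContDiffBump (0 : V)) (hθ : 2 ≤ θ.rIn) :
    tsupport (dyadicPiece θ) ⊆ {w | 1 ≤ ‖w‖ ∧ ‖w‖ ≤ θ.rOut} := by
  refine closure_minimal ?_ ((isClosed_le continuous_const continuous_norm).inter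
    (isClosed_le continuous_norm continuous_const))
  intro w hw
  by_contra hcon
  apply hw
  have hcon' : ¬ (1 ≤ ‖w‖ ∧ ‖w‖ ≤ θ.rOut) := hcon
  rw [not_and_or, not_le, not_le] at hcon'
  rcases hcon' with h | h
  · have h1 : θ w = 1 := θ.one_of_mem_closedBall (by simp; linarith)
    have h2 : θ ((2 : ℝ) • w) = 1 := θ.one_of_mem_closedBall (by simp [norm_smul]; linarith)
    simp [dyadicPiece, h1, h2]
  · have h1 : θ w = 0 := θ.zero_of_le_dist (by simpa using h.le)
    have h2 : θ ((2 : ℝ) • w) = 0 := θ.zero_of_le_dist (by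
      simp [norm_smul]; linarith [norm_nonneg w])
    simp [dyadicPiece, h1, h2]

lemma hasCompactSupport_dyadicPiece (θ : ContDiffBump (0 : V)) (hθ : 2 ≤ θ.rIn) :
    HasCompactSupport (dyadicPiece θ) := by
  refine (isCompact_closedBall (0 : V) θ.rOut).of_isClosed_subset (isClosed_tsupport _) ?_
  intro w hw
  simpa using (tsupport_dyadicPiece_subset θ hθ hw).2

/-- The dyadic pieces telescope to the cutoff, up to a bump around the origin. -/
lemma sum_dyadicPiece (θ : ContDiffBump (0 : V)) (m : ℕ) (u : V) :
    ∑ j ∈ Finset.range m, dyadicPiece θ ((2 : ℝ) ^ j • u) = (θ u : ℂ) - θ ((2 : ℝ) ^ m • u) := by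
  have := Finset.sum_range_sub' (fun j => (θ ((2 : ℝ) ^ j • u) : ℂ)) m
  simp only [pow_zero, one_smul] at this
  rw [← this]
  refine Finset.sum_congr rfl fun j _ => ?_
  simp only [dyadicPiece, smul_smul]
  rw [pow_succ']

variable [MeasurableSpace V] [BorelSpace V]

lemma measurable_exp_phase {F : V → V} (hF : Measurable F) (y : V) :
    Measurable fun u => Complex.exp (Complex.I * phase F y u) := by
  have : Measurable (phase F y) := by
    unfold phase
    exact (hF.inner measurable_const).const_mul _
  exact Complex.measurable_exp.comp ((Complex.measurable_ofReal.comp this).const_mul _)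

lemma fourierMass_lt_top {l : ℕ} (hl : Module.finrank ℝ V < 2 * l) {χ : V → ℂ}
    (hχ : ContDiff ℝ l χ) (hχs : HasCompactSupport χ) : fourierMass χ < ∞ := by
  obtain ⟨r, hr⟩ := hχs.isBounded.subset_closedBall (0 : V)
  obtain ⟨C, hC, hCf⟩ := exists_fourierMass_le_of_iteratedFDeriv_le V hl r
  obtain ⟨A, hA⟩ := hχs.exists_bound_of_continuous hχ.continuous
  obtain ⟨B, hB⟩ := (hχs.iteratedFDeriv l).exists_bound_of_continuous
    (hχ.continuous_iteratedFDeriv le_rfl)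
  have hA0 := (norm_nonneg _).trans (hA 0)
  have hB0 := (norm_nonneg _).trans (hB 0)
  refine (hCf χ (A + B) 1 (by positivity) one_pos hχ hr (fun u => (hA u).trans (by linarith))
    (fun u => (hB u).trans (by simpa using hA0))).trans_lt ENNReal.ofReal_lt_top

lemma exists_fourierMass_mul_exp_le {l : ℕ} (hl : Module.finrank ℝ V < 2 * l) {χ : V → ℂ}
    (hχ : ContDiff ℝ l χ) (hχs : HasCompactSupport χ) :
    ∃ C : ℝ, 0 ≤ C ∧ ∀ (U : Set V) (φ : V → ℝ) (lam : ℝ), IsOpen U → tsupport χ ⊆ U →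
      ContDiffOn ℝ l φ U → 0 ≤ lam →
      (∀ k ≤ l, ∀ u ∈ tsupport χ, ‖iteratedFDeriv ℝ k φ u‖ ≤ lam) →
      fourierMass (fun u => χ u * Complex.exp (Complex.I * φ u)) ≤
        ENNReal.ofReal (C * (1 + lam) ^ ((Module.finrank ℝ V : ℝ) / 2)) := by
  obtain ⟨C, hC, h⟩ := exists_fourierMass_mul_exp_sub_one_le hl hχ hχs
  have hfin := fourierMass_lt_top hl hχ hχs
  refine ⟨C + (fourierMass χ).toReal, by positivity, ?_⟩
  intro U φ lam hU hχU hφ hlam hb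
  have hint : Integrable χ := hχ.continuous.integrable_of_hasCompactSupport hχs
  have hcont : Continuous (fun u => χ u * (Complex.exp (Complex.I * φ u) - 1)) := by
    rw [continuous_iff_continuousAt]
    intro u
    by_cases hu : u ∈ tsupport χ
    · have := hφ.continuousOn.continuousAt (hU.mem_nhds (hχU hu))
      exact hχ.continuous.continuousAt.mul (by fun_prop)
    · have h1 := notMem_tsupport_iff_eventuallyEq.1 hu
      refine (continuousAt_const (y := (0 : ℂ))).congr ?_
      filter_upwards [h1] with v hv
      simp [hv]
  have hint2 : Integrable (fun u => χ u * (Complex.exp (Complex.I * φ u) - 1)) :=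
    hcont.integrable_of_hasCompactSupport hχs.mul_right
  have h1 : (1 : ℝ) ≤ (1 + lam) ^ ((Module.finrank ℝ V : ℝ) / 2) :=
    Real.one_le_rpow (by linarith) (by positivity)
  have h2 : lam / (1 + lam) ≤ 1 := by
    rw [div_le_one (by linarith)]
    linarith
  calc fourierMass (fun u => χ u * Complex.exp (Complex.I * φ u))
      = fourierMass (fun u => χ u * (Complex.exp (Complex.I * φ u) - 1) + χ u) := by
        congr with u
        ring
    _ ≤ _ := fourierMass_add_le hint2 hint
    _ ≤ ENNReal.ofReal (C * (1 + lam) ^ ((Module.finrank ℝ V : ℝ) / 2)) +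
        ENNReal.ofReal ((fourierMass χ).toReal * (1 + lam) ^ ((Module.finrank ℝ V : ℝ) / 2)) := by
        refine add_le_add ((h U φ lam hU hχU hφ hlam hb).trans ?_) ?_
        · refine ENNReal.ofReal_le_ofReal ?_
          gcongr
          exact mul_le_of_le_one_left (by positivity) h2
        · rw [ENNReal.le_ofReal_iff_toReal_le hfin.ne (by positivity)]
          exact le_mul_of_one_le_right ENNReal.toReal_nonneg h1
    _ = _ := by
        rw [← ENNReal.ofReal_add (by positivity) (by positivity)]
        congr 1
        ring

/-- Lower semicontinuity of the `𝓕L¹` norm under dominated convergence (Fatou's lemma). -/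
lemma fourierMass_le_of_tendsto {S : ℕ → V → ℂ} {f : V → ℂ} {bound : V → ℝ} {B : ℝ≥0∞}
    (hS : ∀ m, AEStronglyMeasurable (S m) volume) (hbound : Integrable bound)
    (hSb : ∀ m, ∀ᵐ u, ‖S m u‖ ≤ bound u)
    (hlim : ∀ᵐ u, Filter.Tendsto (fun m => S m u) Filter.atTop (nhds (f u)))
    (hB : ∀ m, fourierMass (S m) ≤ B) : fourierMass f ≤ B := by
  have hSi : ∀ m, Integrable (S m) := fun m => hbound.mono' (hS m) (hSb m)
  have h : ∀ t, Filter.Tendsto (fun m => 𝓕 (S m) t) Filter.atTop (nhds (𝓕 f t)) := by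
    intro t
    simp only [Real.fourier_eq]
    refine tendsto_integral_of_dominated_convergence bound (fun m =>
      ((Real.fourierIntegral_convergent_iff t).2 (hSi m)).1) hbound (fun m => ?_) ?_
    · filter_upwards [hSb m] with u hu
      rwa [Circle.norm_smul]
    · filter_upwards [hlim] with u hu
      exact hu.const_smul _
  calc fourierMass f = ∫⁻ t, Filter.liminf (fun m => ‖𝓕 (S m) t‖ₑ) Filter.atTop := by
        unfold fourierMass
        congr with t
        exact ((h t).enorm.liminf_eq).symm
    _ ≤ Filter.liminf (fun m => fourierMass (S m)) Filter.atTop :=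
        lintegral_liminf_le fun m => (continuous_fourier (hSi m)).measurable.enorm
    _ ≤ B := by
        refine Filter.liminf_le_of_frequently_le' (Filter.Frequently.of_forall hB)

/-- The bound for one dyadic piece, as a fraction of the bound for the largest one. -/
lemma dyadic_bound {n : ℕ} (hn : 1 ≤ n) {A p : ℝ} (hA : 0 ≤ A) (hp : 0 ≤ p) (hp1 : p ≤ 1) :
    A * p / (1 + A * p) * (1 + A * p) ^ ((n : ℝ) / 2) ≤ √p * (1 + A) ^ ((n : ℝ) / 2) := by
  have h1 : 0 ≤ A * p := by positivity
  have h2 : 0 < 1 + A * p := by linarith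
  have hAp : A * p ≤ A := mul_le_of_le_one_right hA hp1
  have hn' : (1 : ℝ) ≤ n := by exact_mod_cast hn
  have split : ∀ x : ℝ, 0 < x → x ^ ((n : ℝ) / 2) = √x * x ^ (((n : ℝ) - 1) / 2) := by
    intro x hx
    rw [Real.sqrt_eq_rpow, ← Real.rpow_add hx]
    congr 1
    ring
  have h3 : A * p / (1 + A * p) * √(1 + A * p) ≤ √p * √(1 + A) := by
    rw [← Real.sqrt_mul hp]
    refine Real.le_sqrt_of_sq_le ?_
    rw [mul_pow, Real.sq_sqrt h2.le, div_pow, div_mul_eq_mul_div, div_le_iff₀ (by positivity)]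
    nlinarith [mul_nonneg hp hA, mul_nonneg (mul_nonneg hp hA) hA, mul_nonneg hp hp,
      mul_nonneg h1 h1, mul_nonneg (mul_nonneg h1 h1) hp, mul_nonneg (mul_nonneg h1 h1) h1]
  rw [split _ h2, split _ (by linarith : 0 < 1 + A), ← mul_assoc, ← mul_assoc]
  refine mul_le_mul h3 ?_ (by positivity) (by positivity)
  exact Real.rpow_le_rpow h2.le (by linarith) (by linarith)

/-- The contribution of the `j`-th dyadic annulus, which decays geometrically in `j`. -/
lemma exists_fourierMass_dyadicPiece_le {F : V → V} {l : ℕ}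
    (hn : 1 ≤ Module.finrank ℝ V) (hl : Module.finrank ℝ V < 2 * l)
    (hF : ContDiffOn ℝ l F {u | u ≠ 0}) {γ C : ℝ} (hγ : -1 < γ) (hγ' : γ ≤ 1) (hC : 0 ≤ C)
    (θ : ContDiffBump (0 : V)) (hθ : 2 ≤ θ.rIn)
    (hFb : ∀ k ≤ l, ∀ u, u ≠ 0 → ‖u‖ ≤ θ.rOut →
      ‖iteratedFDeriv ℝ k F u‖ ≤ C * ‖u‖ ^ (γ + 1 - (k : ℝ))) :
    ∃ C' : ℝ, 0 ≤ C' ∧ ∀ (y : V) (j : ℕ), fourierMass (fun u => dyadicPiece θ ((2 : ℝ) ^ j • u) *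
      (Complex.exp (Complex.I * phase F y u) - 1)) ≤
        ENNReal.ofReal (C' * (1 + 7 * C * θ.rOut ^ 2 * ‖y‖) ^ ((Module.finrank ℝ V : ℝ) / 2) *
          √((1 / 2 : ℝ) ^ (γ + 1)) ^ j) := by
  obtain ⟨C₁, hC₁, hχest⟩ := exists_fourierMass_mul_exp_sub_one_le hl (contDiff_dyadicPiece θ l)
    (hasCompactSupport_dyadicPiece θ hθ)
  refine ⟨C₁, hC₁, fun y j => ?_⟩
  have hχsub := tsupport_dyadicPiece_subset θ hθ
  set K := 7 * C * θ.rOut ^ 2 with hK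
  have hK0 : 0 ≤ K := by positivity
  set c : ℝ := ((2 : ℝ) ^ j)⁻¹ with hc
  have hc0 : 0 < c := by positivity
  have hc1 : c ≤ 1 := inv_le_one_of_one_le₀ (one_le_pow₀ (by norm_num))
  have h2c : ∀ u : V, c • (2 : ℝ) ^ j • u = u := fun u => by
    rw [smul_smul, hc, inv_mul_cancel₀ (by positivity), one_smul]
  have hsj : √(c ^ (γ + 1)) = √((1 / 2 : ℝ) ^ (γ + 1)) ^ j := by
    have h2 : (0 : ℝ) ≤ 1 / 2 := by norm_num
    rw [hc, ← inv_pow, ← one_div, ← Real.rpow_natCast, ← Real.rpow_natCast, Real.sqrt_eq_rpow,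
      Real.sqrt_eq_rpow, ← Real.rpow_mul h2, ← Real.rpow_mul h2, ← Real.rpow_mul h2,
      ← Real.rpow_mul h2]
    congr 1
    ring
  have hsmooth : ContDiffOn ℝ l (fun w : V => phase F y (c • w)) {u | u ≠ 0} := by
    have h1 : ContDiffOn ℝ l (fun w : V => F (c • w)) {u | u ≠ 0} :=
      hF.comp (contDiff_const_smul c).contDiffOn fun w hw => smul_ne_zero hc0.ne' hw
    simp only [phase_eq]
    exact (phaseCLM y).contDiff.comp_contDiffOn h1
  have hbd := hχest {u | u ≠ 0} (fun w => phase F y (c • w)) (K * ‖y‖ * c ^ (γ + 1)) isOpen_ne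
    (fun w hw => norm_pos_iff.1 (zero_lt_one.trans_le (hχsub hw).1)) hsmooth (by positivity)
    (fun k hk w hw => norm_iteratedFDeriv_phase_comp_smul_le hF hγ' hC hFb y hc0 hc1 (hχsub hw).1
      (hχsub hw).2 hk)
  have hdil := fourierMass_comp_smul (fun w => dyadicPiece θ w *
    (Complex.exp (Complex.I * phase F y (c • w)) - 1)) (c := (2 : ℝ) ^ j) (by positivity)
  simp only [h2c] at hdil
  rw [hdil]
  refine hbd.trans (ENNReal.ofReal_le_ofReal ?_)
  rw [mul_assoc C₁]
  refine mul_le_mul_of_nonneg_left ?_ hC₁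
  refine (dyadic_bound hn (by positivity) (by positivity)
    (Real.rpow_le_one hc0.le hc1 (by linarith))).trans (le_of_eq ?_)
  rw [hsj, mul_comm]

/-- The estimate near the origin: the cutoff `θ` is split into dyadic annuli, which are
rescaled to unit size. -/
lemma exists_fourierMass_bump_mul_exp_phase_le {F : V → V} {l : ℕ}
    (hn : 1 ≤ Module.finrank ℝ V) (hl : Module.finrank ℝ V < 2 * l)
    (hF : ContDiffOn ℝ l F {u | u ≠ 0}) (hFm : Measurable F) {γ C : ℝ} (hγ : -1 < γ) (hγ' : γ ≤ 1)
    (hC : 0 ≤ C) (θ : ContDiffBump (0 : V)) (hθ : 2 ≤ θ.rIn)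
    (hFb : ∀ k ≤ l, ∀ u, u ≠ 0 → ‖u‖ ≤ θ.rOut →
      ‖iteratedFDeriv ℝ k F u‖ ≤ C * ‖u‖ ^ (γ + 1 - (k : ℝ))) :
    ∃ C' : ℝ, 0 ≤ C' ∧ ∀ y, fourierMass (fun u => (θ u : ℂ) *
      Complex.exp (Complex.I * phase F y u)) ≤
        ENNReal.ofReal (C' * (1 + ‖y‖) ^ ((Module.finrank ℝ V : ℝ) / 2)) := by
  obtain ⟨C₁, hC₁, hpiece⟩ := exists_fourierMass_dyadicPiece_le hn hl hF hγ hγ' hC θ hθ hFb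
  set a : ℝ := (Module.finrank ℝ V : ℝ) / 2 with ha
  have ha0 : 0 ≤ a := by positivity
  have hθfin := fourierMass_lt_top hl (contDiff_ofReal_bump θ l) (hasCompactSupport_ofReal_bump θ)
  set K := 7 * C * θ.rOut ^ 2 with hK
  have hK0 : 0 ≤ K := by positivity
  set s : ℝ := √((1 / 2 : ℝ) ^ (γ + 1)) with hs
  have hs0 : 0 ≤ s := Real.sqrt_nonneg _
  have hs1 : s < 1 := by
    rw [hs, Real.sqrt_lt' one_pos, one_pow]
    exact Real.rpow_lt_one (by norm_num) (by norm_num) (by linarith)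
  have hs2 : 0 < 1 - s := by linarith
  refine ⟨(fourierMass (fun u => (θ u : ℂ))).toReal + C₁ * (1 - s)⁻¹ * (1 + K) ^ a,
    by positivity, ?_⟩
  intro y
  set e : V → ℂ := fun u => Complex.exp (Complex.I * phase F y u) with he
  have hem : AEStronglyMeasurable (fun u => e u - 1) volume :=
    ((measurable_exp_phase hFm y).sub_const 1).aestronglyMeasurable
  have hen : ∀ u, ‖e u - 1‖ ≤ 2 := norm_exp_I_phase_sub_one_le F y
  have hθint : Integrable (fun u => (θ u : ℂ)) :=
    (contDiff_ofReal_bump θ 0).continuous.integrable_of_hasCompactSupport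
      (hasCompactSupport_ofReal_bump θ)
  have hχjint : ∀ j : ℕ, Integrable (fun u => dyadicPiece θ ((2 : ℝ) ^ j • u) * (e u - 1)) := by
    intro j
    have h1 : Integrable (fun u => dyadicPiece θ ((2 : ℝ) ^ j • u)) :=
      ((contDiff_dyadicPiece θ 0).continuous.integrable_of_hasCompactSupport
        (hasCompactSupport_dyadicPiece θ hθ)).comp_smul (by positivity)
    exact h1.mul_bdd (c := 2) hem (Filter.Eventually.of_forall hen)
  have hSum : fourierMass (fun u => (θ u : ℂ) * (e u - 1)) ≤
      ENNReal.ofReal (C₁ * (1 + K * ‖y‖) ^ a * (1 - s)⁻¹) := by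
    -- the sums telescope to `θ u - θ (2 ^ m u)`, which tends to `θ u` for `u ≠ 0`
    have : Nontrivial V := Module.finrank_pos_iff (R := ℝ).1 hn
    refine fourierMass_le_of_tendsto
      (S := fun m u => ∑ j ∈ Finset.range m, dyadicPiece θ ((2 : ℝ) ^ j • u) * (e u - 1))
      (bound := fun u => 2 * (Metric.closedBall (0 : V) θ.rOut).indicator (fun _ => (1:ℝ)) u)
      (fun m => (integrable_finsetSum _ fun j _ => hχjint j).1) ?_ ?_ ?_ ?_
    · refine Integrable.const_mul ?_ _
      exact (integrable_indicator_iff measurableSet_closedBall).2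
        (integrableOn_const measure_closedBall_lt_top.ne)
    · intro m
      refine Filter.Eventually.of_forall fun u => ?_
      rw [← Finset.sum_mul, sum_dyadicPiece, norm_mul, mul_comm]
      refine mul_le_mul (hen u) ?_ (norm_nonneg _) (by norm_num)
      rw [← Complex.ofReal_sub, Complex.norm_real, Real.norm_eq_abs]
      by_cases hu : u ∈ Metric.closedBall (0 : V) θ.rOut
      · rw [Set.indicator_of_mem hu, abs_le]
        constructor <;> linarith [θ.nonneg' u, θ.le_one (x := u), θ.nonneg' ((2 : ℝ) ^ m • u),
          θ.le_one (x := (2 : ℝ) ^ m • u)]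
      · rw [Set.indicator_of_notMem hu]
        have h0 : θ.rOut < ‖u‖ := by simpa using hu
        have h1 : θ u = 0 := θ.zero_of_le_dist (by simpa using h0.le)
        have h2 : θ ((2 : ℝ) ^ m • u) = 0 := θ.zero_of_le_dist (by
          rw [dist_zero_right, norm_smul, Real.norm_of_nonneg (by positivity)]
          exact h0.le.trans (le_mul_of_one_le_left (norm_nonneg _) (one_le_pow₀ (by norm_num))))
        simp [h1, h2]
    · have hne : ∀ᵐ u : V, u ≠ 0 := by
        simp [ae_iff]
      filter_upwards [hne] with u hu
      refine tendsto_const_nhds.congr' ?_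
      have hlim : Filter.Tendsto (fun m : ℕ => (2 : ℝ) ^ m * ‖u‖) Filter.atTop Filter.atTop :=
        (tendsto_pow_atTop_atTop_of_one_lt (by norm_num)).atTop_mul_const (norm_pos_iff.2 hu)
      filter_upwards [hlim.eventually_ge_atTop θ.rOut] with m hm
      rw [← Finset.sum_mul, sum_dyadicPiece, θ.zero_of_le_dist (x := (2 : ℝ) ^ m • u) (by
          rwa [dist_zero_right, norm_smul, Real.norm_of_nonneg (by positivity)])]
      simp
    · intro m
      refine (fourierMass_sum_le _ fun j _ => hχjint j).trans ?_
      refine (Finset.sum_le_sum fun j _ => hpiece y j).trans ?_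
      rw [← ENNReal.ofReal_sum_of_nonneg (fun j _ => by positivity), ← Finset.mul_sum]
      refine ENNReal.ofReal_le_ofReal (mul_le_mul_of_nonneg_left ?_ (by positivity))
      rw [← tsum_geometric_of_lt_one hs0 hs1]
      exact (summable_geometric_of_lt_one hs0 hs1).sum_le_tsum _ (fun j _ => by positivity)
  have h1 : (1 : ℝ) ≤ (1 + ‖y‖) ^ a := Real.one_le_rpow (by linarith [norm_nonneg y]) ha0
  have h2 : (1 + K * ‖y‖) ^ a ≤ (1 + K) ^ a * (1 + ‖y‖) ^ a := by
    rw [← Real.mul_rpow (by positivity) (by positivity)]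
    refine Real.rpow_le_rpow (by positivity) ?_ ha0
    nlinarith [norm_nonneg y]
  calc fourierMass (fun u => (θ u : ℂ) * e u)
      = fourierMass (fun u => (θ u : ℂ) + (θ u : ℂ) * (e u - 1)) := by
        congr with u
        ring
    _ ≤ _ := fourierMass_add_le hθint (hθint.mul_bdd (c := 2) hem (Filter.Eventually.of_forall hen))
    _ ≤ ENNReal.ofReal ((fourierMass (fun u => (θ u : ℂ))).toReal * (1 + ‖y‖) ^ a) +
        ENNReal.ofReal (C₁ * (1 - s)⁻¹ * (1 + K) ^ a * (1 + ‖y‖) ^ a) := by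
        refine add_le_add ?_ (hSum.trans (ENNReal.ofReal_le_ofReal ?_))
        · rw [ENNReal.le_ofReal_iff_toReal_le hθfin.ne (by positivity)]
          exact le_mul_of_one_le_right ENNReal.toReal_nonneg h1
        · calc _ ≤ C₁ * ((1 + K) ^ a * (1 + ‖y‖) ^ a) * (1 - s)⁻¹ := by gcongr
            _ = _ := by ring
    _ = _ := by
        rw [← ENNReal.ofReal_add (by positivity) (by positivity)]
        congr 1
        ring

end Near

/-! ### Taylor remainders and the local multiplier estimate -/

section Multiplier

variable {V : Type*} [NormedAddCommGroup V] [InnerProductSpace ℝ V]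

/-- The remainder of the first-order Taylor expansion of `F` at `x`. -/
noncomputable def taylorRemainder (F : V → V) (x w : V) : V := F (w + x) - F x - fderiv ℝ F x w

/-- Bounds on the derivatives of `F` of order at least `2` bound all derivatives of the
first-order Taylor remainder. -/
lemma norm_iteratedFDeriv_taylorRemainder_le {F : V → V} {N : ℕ} (hN : 2 ≤ N) {x : V} {s C : ℝ}
    (hs : 1 ≤ s) (hF : ContDiffOn ℝ N F (Metric.ball x s))
    (hb : ∀ k, 2 ≤ k → k ≤ N → ∀ u ∈ Metric.ball x s, ‖iteratedFDeriv ℝ k F u‖ ≤ C) :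
    ContDiffOn ℝ N (taylorRemainder F x) (Metric.ball 0 s) ∧
    ∀ k ≤ N, ∀ w ∈ Metric.ball (0 : V) s,
      ‖iteratedFDeriv ℝ k (taylorRemainder F x) w‖ ≤ C * s ^ 2 := by
  have hs0 : 0 < s := by linarith
  have hmem : ∀ w ∈ Metric.ball (0 : V) s, w + x ∈ Metric.ball x s := by
    intro w hw
    simpa using hw
  have hat : ∀ u ∈ Metric.ball x s, ContDiffAt ℝ N F u := fun u hu =>
    hF.contDiffAt (Metric.isOpen_ball.mem_nhds hu)
  have hC : 0 ≤ C := (norm_nonneg _).trans (hb 2 le_rfl hN x (Metric.mem_ball_self hs0))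
  have hdiff : ∀ u ∈ Metric.ball x s, DifferentiableAt ℝ F u := fun u hu =>
    (hat u hu).differentiableAt (by simp; omega)
  have hdiff2 : ∀ u ∈ Metric.ball x s, DifferentiableAt ℝ (fderiv ℝ F) u := fun u hu =>
    ((hat u hu).fderiv_right (m := 1) (by exact_mod_cast hN)).differentiableAt one_ne_zero
  have hfd : ∀ w ∈ Metric.ball (0 : V) s,
      fderiv ℝ (taylorRemainder F x) w = fderiv ℝ F (w + x) - fderiv ℝ F x := by
    intro w hw
    have h1 : HasFDerivAt (fun w => F (w + x)) (fderiv ℝ F (w + x)) w :=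
      (hasFDerivAt_comp_add_right x).2 (hdiff _ (hmem w hw)).hasFDerivAt
    exact ((h1.sub_const (F x)).sub (fderiv ℝ F x).hasFDerivAt).fderiv
  have h1 : ∀ w ∈ Metric.ball (0 : V) s, ‖fderiv ℝ (taylorRemainder F x) w‖ ≤ C * s := by
    intro w hw
    rw [hfd w hw]
    have := (convex_ball x s).norm_image_sub_le_of_norm_fderiv_le (𝕜 := ℝ) (f := fderiv ℝ F)
      (C := C) hdiff2 (fun u hu => by
        rw [← norm_iteratedFDeriv_one, norm_iteratedFDeriv_fderiv]
        exact hb 2 le_rfl hN u hu) (Metric.mem_ball_self hs0) (hmem w hw)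
    refine this.trans ?_
    have hw' : ‖w‖ ≤ s := by simpa using (Metric.mem_ball.1 hw).le
    rw [add_sub_cancel_right]
    gcongr
  have hss : s ≤ s ^ 2 := by nlinarith
  refine ⟨?_, ?_⟩
  · have h2 : ContDiffOn ℝ N (fun w => F (w + x)) (Metric.ball 0 s) :=
      hF.comp (contDiff_id.add contDiff_const).contDiffOn hmem
    exact (h2.sub contDiffOn_const).sub (fderiv ℝ F x).contDiff.contDiffOn
  intro k hk w hw
  rcases Nat.lt_or_ge k 2 with hk2 | hk2
  · interval_cases k
    · rw [norm_iteratedFDeriv_zero]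
      have hR : ∀ w ∈ Metric.ball (0 : V) s, DifferentiableAt ℝ (taylorRemainder F x) w := by
        intro w hw
        have h2 : DifferentiableAt ℝ (fun w => F (w + x)) w :=
          differentiableAt_comp_add_right x |>.2 (hdiff _ (hmem w hw))
        exact (h2.sub_const (F x)).sub (fderiv ℝ F x).differentiableAt
      have h0 := (convex_ball (0 : V) s).norm_image_sub_le_of_norm_fderiv_le (𝕜 := ℝ) hR h1
        (Metric.mem_ball_self hs0) hw
      have hw' : ‖w‖ ≤ s := by simpa using (Metric.mem_ball.1 hw).le
      have hz : taylorRemainder F x 0 = 0 := by simp [taylorRemainder]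
      rw [hz, sub_zero, sub_zero] at h0
      calc _ ≤ C * s * ‖w‖ := h0
        _ ≤ C * s * s := by gcongr
        _ = _ := by ring
    · rw [norm_iteratedFDeriv_one]
      exact (h1 w hw).trans (by gcongr)
  · obtain ⟨m, rfl⟩ : ∃ m, k = m + 1 := ⟨k - 1, by omega⟩
    have heq : fderiv ℝ (taylorRemainder F x) =ᶠ[nhds w]
        fun w => fderiv ℝ F (w + x) - fderiv ℝ F x := by
      filter_upwards [Metric.isOpen_ball.mem_nhds hw] with v hv
      exact hfd v hv
    have hc : ContDiffAt ℝ m (fun w => fderiv ℝ F (w + x)) w :=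
      ContDiffAt.comp w (((hat _ (hmem w hw)).fderiv_right (m := m) (by exact_mod_cast hk)))
        (contDiffAt_id.add contDiffAt_const)
    have hsub := iteratedFDeriv_sub_apply (i := m) hc (contDiffAt_const (c := fderiv ℝ F x))
    rw [iteratedFDeriv_const_of_ne (by omega), Pi.zero_apply, sub_zero,
      iteratedFDeriv_comp_add_right] at hsub
    rw [← norm_iteratedFDeriv_fderiv, (heq.iteratedFDeriv ℝ m).eq_of_nhds]
    have : ‖iteratedFDeriv ℝ m (fun w => fderiv ℝ F (w + x) - fderiv ℝ F x) w‖ ≤ C := by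
      change ‖iteratedFDeriv ℝ m ((fun w => fderiv ℝ F (w + x)) - fun _ => fderiv ℝ F x) w‖ ≤ C
      rw [hsub, norm_iteratedFDeriv_fderiv]
      exact hb (m + 1) hk2 hk _ (hmem w hw)
    exact this.trans (le_mul_of_one_le_right hC (one_le_pow₀ hs))

variable [FiniteDimensional ℝ V]

/-- By compactness, a homogeneous bound on the punctured unit ball extends to larger balls. -/
lemma exists_norm_iteratedFDeriv_le_rpow {F : V → V} {l : ℕ} (hF : ContDiffOn ℝ l F {u | u ≠ 0})
    {γ : ℝ} (hnear : ∀ k ≤ l, ∃ C : ℝ, ∀ u, u ≠ 0 → ‖u‖ ≤ 1 →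
      ‖iteratedFDeriv ℝ k F u‖ ≤ C * ‖u‖ ^ (γ + 1 - (k : ℝ))) (M : ℝ) :
    ∃ C : ℝ, 0 ≤ C ∧ ∀ k ≤ l, ∀ u, u ≠ 0 → ‖u‖ ≤ M →
      ‖iteratedFDeriv ℝ k F u‖ ≤ C * ‖u‖ ^ (γ + 1 - (k : ℝ)) := by
  have key : ∀ k : ℕ, ∃ C : ℝ, k ≤ l → ∀ u, u ≠ 0 → ‖u‖ ≤ M →
      ‖iteratedFDeriv ℝ k F u‖ ≤ C * ‖u‖ ^ (γ + 1 - (k : ℝ)) := by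
    intro k
    by_cases hk : k ≤ l
    swap
    · exact ⟨0, fun h => absurd h hk⟩
    obtain ⟨C₁, hC₁⟩ := hnear k hk
    set S : Set V := {u | 1 ≤ ‖u‖} ∩ Metric.closedBall 0 M with hS
    have hScomp : IsCompact S := (isCompact_closedBall (0 : V) M).inter_left
      (isClosed_le continuous_const continuous_norm)
    have hS0 : ∀ u ∈ S, u ≠ 0 := fun u hu =>
      norm_pos_iff.1 (lt_of_lt_of_le one_pos hu.1)
    have hcont : ContinuousOn (fun u => ‖u‖ ^ (-(γ + 1 - (k : ℝ))) • iteratedFDeriv ℝ k F u) S := by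
      have hc1 : ContinuousOn (fun u : V => ‖u‖ ^ (-(γ + 1 - (k : ℝ)))) S := by
        exact continuous_norm.continuousOn.rpow_const fun u hu =>
          Or.inl (norm_ne_zero_iff.2 (hS0 u hu))
      have hc2 : ContinuousOn (iteratedFDeriv ℝ k F) S := by
        have h1 := hF.continuousOn_iteratedFDerivWithin (m := k) (by exact_mod_cast hk)
          isOpen_ne.uniqueDiffOn
        refine (h1.congr fun u hu => ?_).mono hS0
        exact (iteratedFDerivWithin_of_isOpen k isOpen_ne hu).symm
      exact hc1.smul hc2
    obtain ⟨C₂, hC₂⟩ := hScomp.exists_bound_of_continuousOn hcont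
    refine ⟨max C₁ C₂, fun _ u hu huM => ?_⟩
    have hu0 : 0 < ‖u‖ := norm_pos_iff.2 hu
    rcases le_total ‖u‖ 1 with h1 | h1
    · refine (hC₁ u hu h1).trans ?_
      gcongr
      exact le_max_left _ _
    · have h2 := hC₂ u ⟨h1, by simpa using huM⟩
      rw [norm_smul, Real.norm_of_nonneg (by positivity), Real.rpow_neg hu0.le,
        inv_mul_le_iff₀ (by positivity), mul_comm] at h2
      refine h2.trans ?_
      gcongr
      exact le_max_right _ _
  choose C hC using key
  refine ⟨∑ k ∈ Finset.range (l + 1), |C k|, by positivity, fun k hk u hu huM => ?_⟩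
  refine (hC k hk u hu huM).trans ?_
  gcongr
  refine (le_abs_self _).trans ?_
  exact Finset.single_le_sum (f := fun k => |C k|) (fun i _ => abs_nonneg _)
    (Finset.mem_range.2 (by omega))

variable [MeasurableSpace V] [BorelSpace V]

lemma fourierMass_const_mul (c : ℂ) (f : V → ℂ) :
    fourierMass (fun u => c * f u) = ‖c‖ₑ * fourierMass f := by
  unfold fourierMass
  rw [← lintegral_const_mul' _ _ enorm_ne_top]
  congr with t
  rw [← enorm_mul]
  congr 1
  simp only [Real.fourier_eq, Circle.smul_def, smul_eq_mul]
  rw [← integral_const_mul]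
  congr with u
  ring

/-- `𝓕L¹` is a Banach algebra under multiplication. -/
lemma fourierMass_mul_le {f m : V → ℂ} (hf : Continuous f) (hfi : Integrable f)
    (hf1 : fourierMass f < ∞) (hm : Integrable m) :
    fourierMass (fun u => f u * m u) ≤ fourierMass f * fourierMass m := by
  have hFi : Integrable (𝓕 f) := ⟨(continuous_fourier hfi).aestronglyMeasurable, hf1⟩
  have hinv : 𝓕 (𝓕⁻ f) = f := hf.fourier_fourierInv_eq hfi hFi
  have hneg : 𝓕⁻ f = fun t => 𝓕 f (-t) := funext fun t => Real.fourierInv_eq_fourier_neg f t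
  have h := fourierMass_fourier_mul_le (h := 𝓕⁻ f) (m := m) (by rw [hneg]; exact hFi.comp_neg) hm
  rw [hinv, hneg] at h
  refine h.trans (le_of_eq ?_)
  congr 1
  exact lintegral_neg_eq_self (fun t => ‖𝓕 f t‖ₑ)

/-- The estimate away from the origin. After removing the affine part of the phase, which does
not change the `𝓕L¹` norm, all derivatives of the phase are bounded by a multiple of `‖y‖`. -/
lemma exists_fourierMass_translate_mul_exp_phase_le_of_far {F : V → V} {l : ℕ} (hl0 : 1 ≤ l)
    (hl : Module.finrank ℝ V < 2 * l) (hF : ContDiffOn ℝ (2 * l : ℕ) F {u | 1 < ‖u‖})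
    (hfar : ∀ k, 2 ≤ k → k ≤ 2 * l → ∃ C : ℝ, ∀ u, 1 < ‖u‖ → ‖iteratedFDeriv ℝ k F u‖ ≤ C)
    {G : V → ℂ} (hG : ContDiff ℝ l G) {r : ℝ} (hr : 0 ≤ r)
    (hGr : tsupport G ⊆ Metric.closedBall 0 r) :
    ∃ C' : ℝ, 0 ≤ C' ∧ ∀ x, r + 2 ≤ ‖x‖ → ∀ y, fourierMass (fun u => G (u - x) *
      Complex.exp (Complex.I * phase F y u)) ≤
        ENNReal.ofReal (C' * (1 + ‖y‖) ^ ((Module.finrank ℝ V : ℝ) / 2)) := by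
  have hGs : HasCompactSupport G :=
    (isCompact_closedBall (0 : V) r).of_isClosed_subset (isClosed_tsupport G) hGr
  obtain ⟨C₁, hC₁, hest⟩ := exists_fourierMass_mul_exp_le hl hG hGs
  obtain ⟨C, hC0, hC⟩ : ∃ C : ℝ, 0 ≤ C ∧ ∀ k, 2 ≤ k → k ≤ 2 * l → ∀ u, 1 < ‖u‖ →
      ‖iteratedFDeriv ℝ k F u‖ ≤ C := by
    have : ∀ k : ℕ, ∃ C : ℝ, 2 ≤ k → k ≤ 2 * l → ∀ u, 1 < ‖u‖ → ‖iteratedFDeriv ℝ k F u‖ ≤ C := by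
      intro k
      by_cases hk : 2 ≤ k ∧ k ≤ 2 * l
      · obtain ⟨C, hC⟩ := hfar k hk.1 hk.2
        exact ⟨C, fun _ _ => hC⟩
      · exact ⟨0, fun h1 h2 => absurd ⟨h1, h2⟩ hk⟩
    choose C hC using this
    refine ⟨∑ k ∈ Finset.range (2 * l + 1), |C k|, by positivity, fun k h1 h2 u hu => ?_⟩
    refine (hC k h1 h2 u hu).trans ((le_abs_self _).trans ?_)
    exact Finset.single_le_sum (f := fun k => |C k|) (fun i _ => abs_nonneg _)
      (Finset.mem_range.2 (by omega))
  set s := r + 1 with hs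
  set a : ℝ := (Module.finrank ℝ V : ℝ) / 2 with ha
  have ha0 : 0 ≤ a := by positivity
  set K := 7 * (C * s ^ 2) with hK
  have hK0 : 0 ≤ K := by positivity
  refine ⟨C₁ * (1 + K) ^ a, by positivity, fun x hx y => ?_⟩
  have hball : Metric.ball x s ⊆ {u | 1 < ‖u‖} := by
    intro u hu
    have h1 : ‖u - x‖ < s := by simpa [dist_eq_norm] using hu
    have h2 : ‖x‖ ≤ ‖u‖ + ‖u - x‖ := by
      have := norm_sub_le u (u - x)
      simpa using this
    change 1 < ‖u‖
    linarith
  obtain ⟨hR, hRb⟩ := norm_iteratedFDeriv_taylorRemainder_le (N := 2 * l) (by omega)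
    (by linarith : 1 ≤ s) (hF.mono hball) (fun k h1 h2 u hu => hC k h1 h2 u (hball hu))
  -- the linear part of the phase is `2π ⟪w, p⟫`
  set T : V →L[ℝ] ℝ := (phaseCLM y).comp (fderiv ℝ F x) with hT
  set p : V := (2 * Real.pi)⁻¹ • (InnerProductSpace.toDual ℝ V).symm T with hp
  have hTp : ∀ w, T w = 2 * Real.pi * inner ℝ w p := by
    intro w
    rw [hp, inner_smul_right, real_inner_comm, InnerProductSpace.toDual_symm_apply]
    field_simp
  have hsplit : ∀ w, G w * Complex.exp (Complex.I * phase F y (w + x)) =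
      Complex.exp (Complex.I * phase F y x) * ((Real.fourierChar (inner ℝ w p) : ℂ) *
        (G w * Complex.exp (Complex.I * phase (taylorRemainder F x) y w))) := by
    intro w
    have h1 : phase F y (w + x) = phase F y x + (2 * Real.pi * inner ℝ w p +
        phase (taylorRemainder F x) y w) := by
      rw [← hTp]
      simp only [phase_eq, hT, ContinuousLinearMap.comp_apply, ← map_add]
      congr 1
      simp only [taylorRemainder]
      abel
    rw [h1, Real.fourierChar_apply]
    push_cast
    rw [mul_add, mul_add, Complex.exp_add, Complex.exp_add]
    ring_nf
  calc fourierMass (fun u => G (u - x) * Complex.exp (Complex.I * phase F y u))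
      = fourierMass (fun w => G w * Complex.exp (Complex.I * phase F y (w + x))) := by
        rw [← fourierMass_translate _ x]
        simp
    _ = fourierMass (fun w => G w * Complex.exp (Complex.I * phase (taylorRemainder F x) y w)) := by
        simp only [hsplit]
        rw [fourierMass_const_mul, fourierMass_modulate (fun w => G w *
          Complex.exp (Complex.I * phase (taylorRemainder F x) y w)) p]
        have : ‖Complex.exp (Complex.I * phase F y x)‖ₑ = 1 := by
          rw [← ofReal_norm, norm_exp_I_phase, ENNReal.ofReal_one]
        rw [this, one_mul]
    _ ≤ ENNReal.ofReal (C₁ * (1 + K * ‖y‖) ^ a) := by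
        have hsub : tsupport G ⊆ Metric.ball 0 s :=
          hGr.trans (Metric.closedBall_subset_ball (by linarith))
        have hcomp : phase (taylorRemainder F x) y = phaseCLM y ∘ taylorRemainder F x :=
          funext fun u => phase_eq _ y u
        refine hest (Metric.ball 0 s) (phase (taylorRemainder F x) y) (K * ‖y‖)
          Metric.isOpen_ball hsub ?_ (by positivity) ?_
        · rw [hcomp]
          exact (phaseCLM y).contDiff.comp_contDiffOn (hR.of_le (by exact_mod_cast (by omega)))
        · intro k hk w hw
          have hw' := hsub hw
          rw [hcomp]
          refine ((phaseCLM y).norm_iteratedFDeriv_comp_left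
            (hR.contDiffAt (Metric.isOpen_ball.mem_nhds hw'))
            (by exact_mod_cast (by omega : k ≤ 2 * l))).trans ?_
          calc _ ≤ 7 * ‖y‖ * (C * s ^ 2) := by
                gcongr
                · exact norm_phaseCLM_le y
                · exact hRb k (by omega) w hw'
            _ = _ := by rw [hK]; ring
    _ ≤ _ := by
        refine ENNReal.ofReal_le_ofReal ?_
        rw [mul_assoc C₁ ((1 + K) ^ a)]
        refine mul_le_mul_of_nonneg_left ?_ hC₁
        rw [← Real.mul_rpow (by positivity) (by positivity)]
        refine Real.rpow_le_rpow (by positivity) ?_ ha0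
        nlinarith [norm_nonneg y]

/-- The factors `e^{-2πi F(u)·y}` are multipliers of `𝓕L¹`, locally uniformly in space: their
localizations by the translates of a window have norm `O((1 + ‖y‖) ^ (dim V / 2))`. -/
lemma exists_fourierMass_translate_mul_exp_phase_le {F : V → V} {l : ℕ}
    (hn : 1 ≤ Module.finrank ℝ V) (hl : Module.finrank ℝ V < 2 * l)
    (hF : ContDiffOn ℝ l F {u | u ≠ 0}) (hFm : Measurable F)
    (hF' : ContDiffOn ℝ (2 * l : ℕ) F {u | 1 < ‖u‖}) {γ : ℝ} (hγ : -1 < γ) (hγ' : γ ≤ 1)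
    (hnear : ∀ k ≤ l, ∃ C : ℝ, ∀ u, u ≠ 0 → ‖u‖ ≤ 1 →
      ‖iteratedFDeriv ℝ k F u‖ ≤ C * ‖u‖ ^ (γ + 1 - (k : ℝ)))
    (hfar : ∀ k, 2 ≤ k → k ≤ 2 * l → ∃ C : ℝ, ∀ u, 1 < ‖u‖ → ‖iteratedFDeriv ℝ k F u‖ ≤ C)
    {G : V → ℂ} (hG : ContDiff ℝ l G) (hGs : HasCompactSupport G) :
    ∃ C' : ℝ, 0 ≤ C' ∧ ∀ x y, fourierMass (fun u => G (u - x) *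
      Complex.exp (Complex.I * phase F y u)) ≤
        ENNReal.ofReal (C' * (1 + ‖y‖) ^ ((Module.finrank ℝ V : ℝ) / 2)) := by
  obtain ⟨r, hr0, hr⟩ : ∃ r : ℝ, 0 ≤ r ∧ tsupport G ⊆ Metric.closedBall 0 r := by
    obtain ⟨r, hr⟩ := hGs.isBounded.subset_closedBall (0 : V)
    exact ⟨max r 0, le_max_right _ _, hr.trans (Metric.closedBall_subset_closedBall (le_max_left _ _))⟩
  obtain ⟨C₁, hC₁, hC₁b⟩ := exists_fourierMass_translate_mul_exp_phase_le_of_far (by omega) hl hF'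
    hfar hG hr0 hr
  let θ : ContDiffBump (0 : V) := ⟨2 * r + 2, 2 * r + 3, by linarith, by linarith⟩
  obtain ⟨C₂, hC₂, hC₂b⟩ := exists_norm_iteratedFDeriv_le_rpow hF hnear θ.rOut
  obtain ⟨C₃, hC₃, hC₃b⟩ := exists_fourierMass_bump_mul_exp_phase_le hn hl hF hFm hγ hγ' hC₂ θ
    (by change 2 ≤ 2 * r + 2; linarith) hC₂b
  have hGi : Integrable G := hG.continuous.integrable_of_hasCompactSupport hGs
  have hGfin := fourierMass_lt_top hl hG hGs
  refine ⟨C₁ + (fourierMass G).toReal * C₃, by positivity, fun x y => ?_⟩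
  have hy : 0 ≤ (1 + ‖y‖) ^ ((Module.finrank ℝ V : ℝ) / 2) := by positivity
  rcases le_or_gt (r + 2) ‖x‖ with hx | hx
  · refine (hC₁b x hx y).trans (ENNReal.ofReal_le_ofReal ?_)
    have : 0 ≤ (fourierMass G).toReal * C₃ := by positivity
    nlinarith
  · have hθG : ∀ u, G (u - x) * Complex.exp (Complex.I * phase F y u) =
        G (u - x) * ((θ u : ℂ) * Complex.exp (Complex.I * phase F y u)) := by
      intro u
      by_cases hu : u - x ∈ tsupport G
      · have h1 : ‖u - x‖ ≤ r := by simpa using hr hu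
        have h2 : ‖u‖ ≤ 2 * r + 2 := by
          have := norm_add_le (u - x) x
          rw [sub_add_cancel] at this
          linarith
        have h3 : θ u = 1 := θ.one_of_mem_closedBall (by simpa using h2)
        rw [h3]
        simp
      · rw [image_eq_zero_of_notMem_tsupport hu]
        simp
    have hGx : fourierMass (fun u => G (u - x)) = fourierMass G := by
      simp only [sub_eq_add_neg]
      exact fourierMass_translate G (-x)
    have hmi : Integrable (fun u => (θ u : ℂ) * Complex.exp (Complex.I * phase F y u)) := by
      refine Integrable.mul_bdd (c := 1) ?_ (measurable_exp_phase hFm y).aestronglyMeasurable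
        (Filter.Eventually.of_forall fun u => (norm_exp_I_phase F y u).le)
      exact (contDiff_ofReal_bump θ 0).continuous.integrable_of_hasCompactSupport
        (hasCompactSupport_ofReal_bump θ)
    simp only [hθG]
    refine (fourierMass_mul_le (f := fun u => G (u - x)) (hG.continuous.comp (by fun_prop))
      (hGi.comp_sub_right x) (by rw [hGx]; exact hGfin) hmi).trans ?_
    rw [hGx]
    calc _ ≤ ENNReal.ofReal (fourierMass G).toReal *
          ENNReal.ofReal (C₃ * (1 + ‖y‖) ^ ((Module.finrank ℝ V : ℝ) / 2)) := by
          gcongr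
          · rw [ENNReal.ofReal_toReal hGfin.ne]
          · exact hC₃b y
      _ ≤ _ := by
          rw [← ENNReal.ofReal_mul ENNReal.toReal_nonneg]
          refine ENNReal.ofReal_le_ofReal ?_
          have := mul_nonneg hC₁ hy
          nlinarith

end Multiplier

/-! ### Mixed partial derivatives -/

section MixedPartial

lemma norm_iteratedFDeriv_le_sum_mixedPartial {d k : ℕ}
    (F : EuclideanSpace ℝ (Fin d) → EuclideanSpace ℝ (Fin d)) (u : EuclideanSpace ℝ (Fin d)) :
    ‖iteratedFDeriv ℝ k F u‖ ≤ ∑ s : Fin k → Fin d, ‖mixedPartial s F u‖ := by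
  refine ContinuousMultilinearMap.opNorm_le_bound (by positivity) fun m => ?_
  have hm : m = fun i => ∑ j, m i j • EuclideanSpace.single j (1 : ℝ) := by
    ext i j
    simp [Pi.single_apply]
  conv_lhs => rw [hm, ContinuousMultilinearMap.map_sum]
  refine (norm_sum_le _ _).trans ?_
  rw [Finset.sum_mul]
  refine Finset.sum_le_sum fun s _ => ?_
  rw [ContinuousMultilinearMap.map_smul_univ, norm_smul, mul_comm, norm_prod]
  refine mul_le_mul le_rfl ?_ (by positivity) (norm_nonneg _)
  exact Finset.prod_le_prod (fun i _ => norm_nonneg _) fun i _ => PiLp.norm_apply_le _ _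

/-- Pointwise bounds on all mixed partial derivatives of order `k` bound the `k`-th derivative. -/
lemma exists_norm_iteratedFDeriv_le_of_mixedPartial {d k : ℕ}
    {F : EuclideanSpace ℝ (Fin d) → EuclideanSpace ℝ (Fin d)}
    {S : Set (EuclideanSpace ℝ (Fin d))} {W : EuclideanSpace ℝ (Fin d) → ℝ}
    (h : ∀ s : Fin k → Fin d, ∃ C : ℝ, ∀ u ∈ S, ‖mixedPartial s F u‖ ≤ C * W u) :
    ∃ C : ℝ, ∀ u ∈ S, ‖iteratedFDeriv ℝ k F u‖ ≤ C * W u := by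
  choose C hC using h
  refine ⟨∑ s, C s, fun u hu => (norm_iteratedFDeriv_le_sum_mixedPartial F u).trans ?_⟩
  rw [Finset.sum_mul]
  exact Finset.sum_le_sum fun s _ => hC s u hu

end MixedPartial

/-! ### The Feichtinger algebra -/

section Feichtinger

variable {d : ℕ}

/-- Bounds by a multiple of `fourierL1Norm f` may be checked on each `h` whose transform is `f`. The
assumption `MemFourierL1 f` is what excludes the product `∞ * 0`. -/
lemma le_fourierL1Norm_mul {f : EuclideanSpace ℝ (Fin d) → ℂ} (hf : MemFourierL1 f)
    {A B : ℝ≥0∞} (hB : B ≠ ∞)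
    (h : ∀ h : EuclideanSpace ℝ (Fin d) → ℂ, Integrable h volume → 𝓕 h =ᵐ[volume] f →
      A ≤ (∫⁻ t, ‖h t‖ₑ) * B) :
    A ≤ fourierL1Norm f * B := by
  rcases eq_or_ne B 0 with rfl | hB0
  · obtain ⟨k, hk, hkf⟩ := hf
    simpa using h k hk hkf
  · rw [← ENNReal.div_le_iff hB0 hB]
    refine le_iInf fun k => le_iInf fun hk => ?_
    rw [ENNReal.div_le_iff hB0 hB]
    exact h k hk.1 hk.2

lemma fourierMass_mul_le_fourierL1Norm_mul {f m : EuclideanSpace ℝ (Fin d) → ℂ}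
    (hf : MemFourierL1 f) (hm : Integrable m) (hm' : fourierMass m ≠ ∞) :
    fourierMass (fun u => f u * m u) ≤ fourierL1Norm f * fourierMass m := by
  refine le_fourierL1Norm_mul hf hm' fun h hh hhf => ?_
  have : (fun u => f u * m u) =ᵐ[volume] fun u => 𝓕 h u * m u := by
    filter_upwards [hhf] with u hu
    rw [hu]
  rw [fourierMass_congr_ae this]
  exact fourierMass_fourier_mul_le hh hm

lemma lintegral_enorm_mul_le_fourierL1Norm_mul {f m : EuclideanSpace ℝ (Fin d) → ℂ}
    (hf : MemFourierL1 f) (hm : Integrable m) :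
    ∫⁻ u, ‖f u‖ₑ * ‖m u‖ₑ ≤ fourierL1Norm f * ∫⁻ u, ‖m u‖ₑ := by
  refine le_fourierL1Norm_mul hf hm.2.ne fun h hh hhf => ?_
  rw [← lintegral_const_mul'' _ hm.1.enorm]
  refine lintegral_mono_ae ?_
  filter_upwards [hhf] with u hu
  rw [← hu]
  gcongr
  rw [Real.fourier_eq]
  refine (enorm_integral_le_lintegral_enorm _).trans (le_of_eq ?_)
  congr with t
  rw [enorm_eq_iff_norm_eq, Circle.norm_smul]

/-- `Φ` is a pointwise limit of its products with smooth cutoffs, which are Fourier transforms. -/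
lemma MemM1.aestronglyMeasurable {Φ : EuclideanSpace ℝ (Fin d) → ℂ} (hΦ : MemM1 Φ) :
    AEStronglyMeasurable Φ volume := by
  let θ : ℕ → ContDiffBump (0 : EuclideanSpace ℝ (Fin d)) := fun n =>
    ⟨n + 1, n + 2, by positivity, by linarith⟩
  have hθ : ∀ n, AEStronglyMeasurable (fun t => (θ n t : ℂ) * Φ t) volume := by
    intro n
    obtain ⟨h, hh, hhΦ⟩ := hΦ.1 (fun t => (θ n t : ℂ))
      ⟨Complex.ofRealCLM.contDiff.comp (θ n).contDiff, hasCompactSupport_ofReal_bump _⟩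
    exact (continuous_fourier hh).aestronglyMeasurable.congr hhΦ
  refine aestronglyMeasurable_of_tendsto_ae Filter.atTop hθ (Filter.Eventually.of_forall fun u => ?_)
  refine tendsto_const_nhds.congr' ?_
  obtain ⟨n, hn⟩ := exists_nat_ge ‖u‖
  filter_upwards [Filter.eventually_ge_atTop n] with m hm
  have h1 : ‖u‖ ≤ (θ m).rIn := by
    change ‖u‖ ≤ (m : ℝ) + 1
    have : (n : ℝ) ≤ m := by exact_mod_cast hm
    linarith
  rw [(θ m).one_of_mem_closedBall (by simpa using h1)]
  simp

lemma IsTestFunction.translate {g : EuclideanSpace ℝ (Fin d) → ℂ} (hg : IsTestFunction g)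
    (x : EuclideanSpace ℝ (Fin d)) : IsTestFunction (fun t => g (t - x)) := by
  refine ⟨hg.1.comp (contDiff_id.sub contDiff_const), ?_⟩
  exact hg.2.comp_homeomorph (Homeomorph.subRight x)

lemma IsTestFunction.integrable {g : EuclideanSpace ℝ (Fin d) → ℂ} (hg : IsTestFunction g) :
    Integrable g :=
  hg.1.continuous.integrable_of_hasCompactSupport hg.2

lemma MemM1.memFourierL1_mul_translate {Φ g : EuclideanSpace ℝ (Fin d) → ℂ} (hΦ : MemM1 Φ)
    (hg : IsTestFunction g) (x : EuclideanSpace ℝ (Fin d)) :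
    MemFourierL1 (fun t => Φ t * g (t - x)) := by
  simpa only [mul_comm] using hΦ.1 _ (hg.translate x)

lemma IsTestFunction.lintegral_enorm_sq {g : EuclideanSpace ℝ (Fin d) → ℂ}
    (hg : IsTestFunction g) (hg1 : ∫ t, ‖g t‖ ^ 2 = 1) : ∫⁻ t, ‖g t‖ₑ ^ 2 = 1 := by
  have hc : Continuous (fun t => ‖g t‖ ^ 2) := hg.1.continuous.norm.pow 2
  have hs : HasCompactSupport (fun t => ‖g t‖ ^ 2) :=
    hg.2.mono fun t ht => by simpa using ht
  have h : Integrable (fun t => ‖g t‖ ^ 2) := hc.integrable_of_hasCompactSupport hs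
  have h2 := ofReal_integral_eq_lintegral_ofReal h (Filter.Eventually.of_forall fun t => by positivity)
  rw [hg1, ENNReal.ofReal_one] at h2
  rw [h2]
  congr with t
  rw [ENNReal.ofReal_pow (norm_nonneg _), ofReal_norm]

/-- The Feichtinger algebra is contained in `L¹`. -/
lemma MemM1.integrable {Φ : EuclideanSpace ℝ (Fin d) → ℂ} (hΦ : MemM1 Φ) : Integrable Φ := by
  have hm := hΦ.aestronglyMeasurable
  obtain ⟨g, hg, hg1, hfin⟩ := hΦ.2
  have hgc := hg.1.continuous
  have hg2 := hg.lintegral_enorm_sq hg1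
  refine ⟨hm, ?_⟩
  calc ∫⁻ u, ‖Φ u‖ₑ = ∫⁻ u, ∫⁻ x, ‖Φ u‖ₑ * ‖g (u - x)‖ₑ ^ 2 := by
        congr with u
        rw [lintegral_const_mul' _ _ enorm_ne_top,
          lintegral_sub_left_eq_self (fun t => ‖g t‖ₑ ^ 2) u, hg2, mul_one]
    _ = ∫⁻ x, ∫⁻ u, ‖Φ u‖ₑ * ‖g (u - x)‖ₑ ^ 2 := by
        refine lintegral_lintegral_swap ?_
        refine AEMeasurable.mul hm.enorm.comp_fst ?_
        exact ((hgc.comp (continuous_fst.sub continuous_snd)).enorm.measurable.pow_const 2).aemeasurable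
    _ ≤ ∫⁻ x, fourierL1Norm (fun t => Φ t * g (t - x)) * ∫⁻ u, ‖g u‖ₑ := by
        refine lintegral_mono fun x => ?_
        have := lintegral_enorm_mul_le_fourierL1Norm_mul (hΦ.memFourierL1_mul_translate hg x)
          (hg.translate x).integrable
        rw [lintegral_sub_right_eq_self (fun t => ‖g t‖ₑ) x] at this
        refine le_trans (le_of_eq ?_) this
        congr with u
        rw [enorm_mul, sq, mul_assoc]
    _ < ∞ := by
        rw [lintegral_mul_const' _ _ hg.integrable.2.ne]
        exact ENNReal.mul_lt_top hfin hg.integrable.2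

/-- The Feichtinger algebra is stable under multiplication by functions that are locally in `𝓕L¹`,
uniformly over the translates of a window. -/
lemma MemM1.fourierMass_mul_le {Φ g e : EuclideanSpace ℝ (Fin d) → ℂ} (hΦ : MemM1 Φ)
    (hg : IsTestFunction g) (hg1 : ∫ t, ‖g t‖ ^ 2 = 1) (he : Measurable e) (he1 : ∀ u, ‖e u‖ ≤ 1)
    {B : ℝ≥0∞} (hB : B ≠ ∞)
    (h : ∀ x, fourierMass (fun u => (starRingEnd ℂ) (g (u - x)) * e u) ≤ B) :
    fourierMass (fun u => Φ u * e u) ≤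
      (∫⁻ x, fourierL1Norm (fun t => Φ t * g (t - x))) * B := by
  have hgc := hg.1.continuous
  have hint : Integrable (fun u => Φ u * e u) :=
    hΦ.integrable.mul_bdd (c := 1) he.aestronglyMeasurable (Filter.Eventually.of_forall he1)
  set w : EuclideanSpace ℝ (Fin d) → ℂ := fun t => g t * (starRingEnd ℂ) (g t) with hw
  have hwc : Continuous w := hgc.mul (Complex.continuous_conj.comp hgc)
  have hw1 : ∫ t, w t = 1 := by
    have : w = fun t => ((‖g t‖ ^ 2 : ℝ) : ℂ) := by
      ext t
      simp [hw, Complex.mul_conj, Complex.normSq_eq_norm_sq]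
    have h2 : ∫ t, ((‖g t‖ ^ 2 : ℝ) : ℂ) = ((∫ t, ‖g t‖ ^ 2 : ℝ) : ℂ) := integral_ofReal
    rw [hg1, Complex.ofReal_one] at h2
    rw [this]
    exact h2
  refine (fourierMass_le_lintegral_translates hint hwc
    (hwc.integrable_of_hasCompactSupport hg.2.mul_right) hw1).trans ?_
  rw [← lintegral_mul_const' _ _ hB]
  refine lintegral_mono fun x => ?_
  have hmi : Integrable (fun u => (starRingEnd ℂ) (g (u - x)) * e u) := by
    refine Integrable.mul_bdd (c := 1) ?_ he.aestronglyMeasurable (Filter.Eventually.of_forall he1)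
    exact (hg.translate x).integrable.mono
      ((Complex.continuous_conj.comp (hg.translate x).1.continuous).aestronglyMeasurable)
      (Filter.Eventually.of_forall fun u => by simp)
  calc fourierMass (fun u => Φ u * e u * w (u - x))
      = fourierMass (fun u => (Φ u * g (u - x)) * ((starRingEnd ℂ) (g (u - x)) * e u)) := by
        congr with u
        simp only [hw]
        ring
    _ ≤ _ := fourierMass_mul_le_fourierL1Norm_mul (hΦ.memFourierL1_mul_translate hg x) hmi
        ((h x).trans_lt hB.lt_top).ne
    _ ≤ _ := by
        gcongr
        exact h x

end Feichtinger

/-! ### The kernel, its phase and the weight -/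

section Kernel

variable {d : ℕ}

lemma radialMap_eq_add (β : ℝ → ℝ) (a : ℝ) (u : EuclideanSpace ℝ (Fin d)) :
    radialMap β u = radialMap (fun r => β r - a) u + a • u := by
  simp [radialMap, sub_smul]

/-- The linear part `a u` of the phase only translates the kernel in `x`. -/
lemma oscFactor_eq (β : ℝ → ℝ) (a : ℝ) (x y u : EuclideanSpace ℝ (Fin d)) :
    oscFactor β x y u = (Real.fourierChar (inner ℝ u (x - a • y)) : ℂ) *
      Complex.exp (Complex.I * phase (radialMap (fun r => β r - a)) y u) := by
  rw [oscFactor, Real.fourierChar_apply, ← Complex.exp_add, radialMap_eq_add β a, phase]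
  congr 1
  simp only [inner_add_left, inner_sub_right, real_inner_smul_left, real_inner_smul_right]
  push_cast
  ring

lemma norm_oscFactor (β : ℝ → ℝ) (x y u : EuclideanSpace ℝ (Fin d)) : ‖oscFactor β x y u‖ = 1 := by
  rw [oscFactor_eq β 0, norm_mul, norm_exp_I_phase, Circle.norm_coe, one_mul]

lemma measurable_oscFactor {β : ℝ → ℝ} (hβ : Measurable
      (radialMap β : EuclideanSpace ℝ (Fin d) → EuclideanSpace ℝ (Fin d)))
    (x : EuclideanSpace ℝ (Fin d)) :
    Measurable fun p : EuclideanSpace ℝ (Fin d) × EuclideanSpace ℝ (Fin d) =>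
      oscFactor β x p.1 p.2 := by
  unfold oscFactor
  refine Complex.measurable_exp.comp ((Complex.measurable_ofReal.comp ?_).const_mul _)
  exact ((hβ.comp measurable_snd).inner measurable_fst).sub (measurable_snd.inner measurable_const)

lemma continuous_kernelK {Φ : EuclideanSpace ℝ (Fin d) → ℂ} {β : ℝ → ℝ} (hΦ : Integrable Φ)
    (hβ : Measurable (radialMap β : EuclideanSpace ℝ (Fin d) → EuclideanSpace ℝ (Fin d))) :
    Continuous fun p : EuclideanSpace ℝ (Fin d) × EuclideanSpace ℝ (Fin d) =>
      kernelK Φ β p.1 p.2 := by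
  unfold kernelK
  refine continuous_of_dominated (bound := fun u => ‖Φ u‖) (fun p => ?_) (fun p => ?_) hΦ.norm ?_
  · exact hΦ.1.mul ((measurable_oscFactor hβ p.1).comp
      (measurable_const.prodMk measurable_id)).aestronglyMeasurable
  · exact Filter.Eventually.of_forall fun u => by rw [norm_mul, norm_oscFactor, mul_one]
  · refine Filter.Eventually.of_forall fun u => continuous_const.mul ?_
    unfold oscFactor
    fun_prop

/-- In the variable `x`, the kernel is a translate by `a y` of an inverse Fourier transform. -/
lemma kernelK_eq_fourierInv (Φ : EuclideanSpace ℝ (Fin d) → ℂ) (β : ℝ → ℝ) (a : ℝ)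
    (x y : EuclideanSpace ℝ (Fin d)) :
    kernelK Φ β x y = 𝓕⁻ (fun u => Φ u *
      Complex.exp (Complex.I * phase (radialMap (fun r => β r - a)) y u)) (x - a • y) := by
  rw [kernelK, Real.fourierInv_eq]
  congr with u
  rw [oscFactor_eq β a, Circle.smul_def, smul_eq_mul]
  ring

lemma lintegral_enorm_kernelK (Φ : EuclideanSpace ℝ (Fin d) → ℂ) (β : ℝ → ℝ) (a : ℝ)
    (y : EuclideanSpace ℝ (Fin d)) :
    ∫⁻ x, ‖kernelK Φ β x y‖ₑ = fourierMass (fun u => Φ u *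
      Complex.exp (Complex.I * phase (radialMap (fun r => β r - a)) y u)) := by
  simp only [kernelK_eq_fourierInv Φ β a, Real.fourierInv_eq_fourier_neg]
  rw [lintegral_sub_right_eq_self (fun x => ‖𝓕 (fun u => Φ u *
    Complex.exp (Complex.I * phase (radialMap (fun r => β r - a)) y u)) (-x)‖ₑ) (a • y)]
  exact lintegral_neg_eq_self (fun x => ‖𝓕 (fun u => Φ u *
    Complex.exp (Complex.I * phase (radialMap (fun r => β r - a)) y u)) x‖ₑ)

lemma one_le_weightV {γ : ℝ} (hγ : -1 < γ) (y : EuclideanSpace ℝ (Fin d)) : 1 ≤ weightV γ y :=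
  Real.one_le_rpow (by linarith [norm_nonneg y]) (div_nonneg (Nat.cast_nonneg _) (by linarith))

lemma rpow_half_dim_le_weightV {γ : ℝ} (hγ : -1 < γ) (hγ' : γ ≤ 1)
    (y : EuclideanSpace ℝ (Fin d)) : (1 + ‖y‖) ^ ((d : ℝ) / 2) ≤ weightV γ y := by
  refine Real.rpow_le_rpow_of_exponent_le (by linarith [norm_nonneg y]) ?_
  exact div_le_div_of_nonneg_left (Nat.cast_nonneg _) (by linarith) (by linarith)

lemma continuous_weightV (γ : ℝ) :
    Continuous (weightV γ : EuclideanSpace ℝ (Fin d) → ℝ) := by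
  unfold weightV
  exact (continuous_const.add continuous_norm).rpow_const fun y =>
    Or.inl (by linarith [norm_nonneg y] : 0 < 1 + ‖y‖).ne'

lemma integrable_of_integrable_weightV_mul {γ : ℝ} (hγ : -1 < γ)
    {f : EuclideanSpace ℝ (Fin d) → ℂ} (hf : Integrable (fun y => (weightV γ y : ℂ) * f y)) :
    Integrable f := by
  have h1 : ∀ y : EuclideanSpace ℝ (Fin d), 0 < weightV γ y := fun y =>
    one_pos.trans_le (one_le_weightV hγ y)
  have hc : Continuous fun y : EuclideanSpace ℝ (Fin d) => (((weightV γ y)⁻¹ : ℝ) : ℂ) :=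
    Complex.continuous_ofReal.comp ((continuous_weightV γ).inv₀ fun y => (h1 y).ne')
  refine (hf.bdd_mul (c := 1) hc.aestronglyMeasurable
    (Filter.Eventually.of_forall fun y => ?_)).congr (Filter.Eventually.of_forall fun y => ?_)
  · rw [Complex.norm_real, Real.norm_of_nonneg (inv_nonneg.2 (h1 y).le)]
    exact inv_le_one_of_one_le₀ (one_le_weightV hγ y)
  · have : (weightV γ y : ℂ) ≠ 0 := by exact_mod_cast (h1 y).ne'
    simp only [Complex.ofReal_inv]
    field_simp

end Kernel

theorem corollary3p5 (d l : ℕ) (hd : 1 ≤ d) (hl : l = d / 2 + 1)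
    (Φ : EuclideanSpace ℝ (Fin d) → ℂ) (hΦ : MemM1 Φ)
    (β : ℝ → ℝ) (γ a : ℝ) (hγ : -1 < γ) (hγ' : γ ≤ 1)
    (hreg : ContDiffOn ℝ l
      (radialMap (fun r => β r - a) : EuclideanSpace ℝ (Fin d) → EuclideanSpace ℝ (Fin d))
      {u | u ≠ 0})
    (hreg' : ContDiffOn ℝ (2 * l : ℕ)
      (radialMap (fun r => β r - a) : EuclideanSpace ℝ (Fin d) → EuclideanSpace ℝ (Fin d))
      {u | 1 < ‖u‖})
    (hnear : ∀ k : ℕ, k ≤ l → ∀ s : Fin k → Fin d, ∃ C : ℝ, 0 < C ∧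
      ∀ u : EuclideanSpace ℝ (Fin d), u ≠ 0 → ‖u‖ ≤ 1 →
        ‖mixedPartial s (radialMap (fun r => β r - a)) u‖ ≤ C * ‖u‖ ^ (γ + 1 - (k : ℝ)))
    (hfar : ∀ k : ℕ, 2 ≤ k → k ≤ 2 * l → ∀ s : Fin k → Fin d, ∃ C : ℝ, 0 < C ∧
      ∀ u : EuclideanSpace ℝ (Fin d), 1 < ‖u‖ →
        ‖mixedPartial s (radialMap (fun r => β r - a)) u‖ ≤ C) :
    -- the integral defining the kernel converges absolutely
    (∀ x y : EuclideanSpace ℝ (Fin d),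
      Integrable (fun u => Φ u * oscFactor β x y u) volume) ∧
    -- there is a constant such that, for all `f ∈ L¹_v`,
    ∃ C : ℝ, 0 < C ∧ ∀ f : EuclideanSpace ℝ (Fin d) → ℂ,
      Integrable (fun y => (weightV γ y : ℂ) * f y) volume →
      -- `A f` is well defined everywhere, both as the integral against the kernel
      -- and as an absolutely convergent double integral,
      (∀ x, Integrable (fun y => kernelK Φ β x y * f y) volume) ∧
      (∀ x, Integrable (fun p : EuclideanSpace ℝ (Fin d) × EuclideanSpace ℝ (Fin d) =>
          oscFactor β x p.1 p.2 * Φ p.2 * f p.1) (volume.prod volume) ∧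
        operatorA Φ β f x = ∫ u, ∫ y, oscFactor β x y u * Φ u * f y) ∧
      -- and `A f ∈ L¹` with `‖A f‖_{L¹} ≤ C ‖f‖_{L¹_v}`
      Integrable (operatorA Φ β f) volume ∧
      ∫ x, ‖operatorA Φ β f x‖ ≤ C * ∫ y, ‖f y‖ * weightV γ y := by
  set F : EuclideanSpace ℝ (Fin d) → EuclideanSpace ℝ (Fin d) := radialMap (fun r => β r - a)
    with hF
  have hΦi := hΦ.integrable
  have hFm : Measurable F := measurable_of_continuousOn_compl_singleton 0 hreg.continuousOn
  have hβm : Measurable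
      (radialMap β : EuclideanSpace ℝ (Fin d) → EuclideanSpace ℝ (Fin d)) := by
    have : (radialMap β : EuclideanSpace ℝ (Fin d) → EuclideanSpace ℝ (Fin d)) =
        fun u => F u + a • u := funext fun u => radialMap_eq_add β a u
    rw [this]
    exact hFm.add (measurable_id.const_smul a)
  have hdim : Module.finrank ℝ (EuclideanSpace ℝ (Fin d)) = d := finrank_euclideanSpace_fin
  obtain ⟨g, hg, hg1, hgfin⟩ := hΦ.2
  -- the local estimate on the oscillating factor
  obtain ⟨C₁, hC₁, hC₁b⟩ := exists_fourierMass_translate_mul_exp_phase_le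
    (G := fun u => (starRingEnd ℂ) (g u)) (l := l)
    (by omega) (by omega) hreg hFm hreg' hγ hγ'
    (fun k hk => by
      obtain ⟨C, hC⟩ := exists_norm_iteratedFDeriv_le_of_mixedPartial (F := F) (k := k)
        (S := {u | u ≠ 0 ∧ ‖u‖ ≤ 1}) (W := fun u => ‖u‖ ^ (γ + 1 - (k : ℝ))) fun s => by
          obtain ⟨C, -, hC⟩ := hnear k hk s
          exact ⟨C, fun u hu => hC u hu.1 hu.2⟩
      exact ⟨C, fun u h1 h2 => hC u ⟨h1, h2⟩⟩)
    (fun k h2 hk => by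
      obtain ⟨C, hC⟩ := exists_norm_iteratedFDeriv_le_of_mixedPartial (F := F) (k := k)
        (S := {u | 1 < ‖u‖}) (W := fun _ => 1) fun s => by
          obtain ⟨C, -, hC⟩ := hfar k h2 hk s
          exact ⟨C, fun u hu => by rw [mul_one]; exact hC u hu⟩
      exact ⟨C, fun u h1 => by simpa using hC u h1⟩)
    ((Complex.conjCLE.contDiff.comp hg.1).of_le (by exact_mod_cast le_top))
    (hg.2.comp_left (g := starRingEnd ℂ) (map_zero _))
  rw [hdim] at hC₁b
  set Q : ℝ := (∫⁻ x, fourierL1Norm (fun t => Φ t * g (t - x))).toReal with hQ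
  set C : ℝ := Q * C₁ + 1 with hC
  have hQ0 : 0 ≤ Q := ENNReal.toReal_nonneg
  have hCpos : 0 < C := by positivity
  have hK : ∀ y, ∫⁻ x, ‖kernelK Φ β x y‖ₑ ≤ ENNReal.ofReal (C * weightV γ y) := by
    intro y
    rw [lintegral_enorm_kernelK Φ β a]
    refine (hΦ.fourierMass_mul_le hg hg1 (measurable_exp_phase hFm y)
      (fun u => (norm_exp_I_phase F y u).le) ENNReal.ofReal_ne_top (fun x => hC₁b x y)).trans ?_
    rw [← ENNReal.ofReal_toReal hgfin.ne, ← ENNReal.ofReal_mul ENNReal.toReal_nonneg]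
    refine ENNReal.ofReal_le_ofReal ?_
    have h1 := rpow_half_dim_le_weightV hγ hγ' y
    have h2 := one_le_weightV hγ y
    have h3 : 0 ≤ Q * C₁ := by positivity
    rw [← mul_assoc]
    nlinarith
  refine ⟨fun x y => ?_, C, hCpos, fun f hf => ?_⟩
  · refine hΦi.mul_bdd (c := 1) ?_ (Filter.Eventually.of_forall fun u => (norm_oscFactor β x y u).le)
    exact ((measurable_oscFactor hβm x).comp
      (measurable_const.prodMk measurable_id)).aestronglyMeasurable
  have hfi := integrable_of_integrable_weightV_mul hγ hf
  have hKc := continuous_kernelK hΦi hβm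
  have hfv : Integrable (fun y => ‖f y‖ * weightV γ y) := by
    refine hf.norm.congr (Filter.Eventually.of_forall fun y => ?_)
    simp only [norm_mul, Complex.norm_real]
    rw [Real.norm_of_nonneg (zero_le_one.trans (one_le_weightV hγ y)), mul_comm]
  have hdouble : ∀ x, Integrable (fun p : EuclideanSpace ℝ (Fin d) × EuclideanSpace ℝ (Fin d) =>
      oscFactor β x p.1 p.2 * Φ p.2 * f p.1) (volume.prod volume) := by
    intro x
    have h1 : Integrable (fun p : EuclideanSpace ℝ (Fin d) × EuclideanSpace ℝ (Fin d) =>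
        f p.1 * Φ p.2) (volume.prod volume) := hfi.mul_prod hΦi
    refine (h1.bdd_mul (c := 1) (measurable_oscFactor hβm x).aestronglyMeasurable
      (Filter.Eventually.of_forall fun p => (norm_oscFactor β x p.1 p.2).le)).congr
      (Filter.Eventually.of_forall fun p => ?_)
    simp only
    ring
  have hprodm : AEStronglyMeasurable
      (fun p : EuclideanSpace ℝ (Fin d) × EuclideanSpace ℝ (Fin d) => kernelK Φ β p.1 p.2 * f p.2)
      (volume.prod volume) := hKc.aestronglyMeasurable.mul hfi.1.comp_snd
  have hprodle : ∫⁻ x, ∫⁻ y, ‖kernelK Φ β x y * f y‖ₑ ≤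
      ENNReal.ofReal (C * ∫ y, ‖f y‖ * weightV γ y) := by
    calc ∫⁻ x, ∫⁻ y, ‖kernelK Φ β x y * f y‖ₑ = ∫⁻ y, ∫⁻ x, ‖kernelK Φ β x y * f y‖ₑ :=
          lintegral_lintegral_swap hprodm.enorm
      _ = ∫⁻ y, (∫⁻ x, ‖kernelK Φ β x y‖ₑ) * ‖f y‖ₑ := by
          congr with y
          rw [← lintegral_mul_const' _ _ enorm_ne_top]
          congr with x
          rw [enorm_mul]
      _ ≤ ∫⁻ y, ENNReal.ofReal (C * (‖f y‖ * weightV γ y)) := by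
          refine lintegral_mono fun y => ?_
          refine (mul_le_mul_left (hK y) _).trans (le_of_eq ?_)
          rw [← ofReal_norm, ← ENNReal.ofReal_mul (mul_nonneg hCpos.le
            (zero_le_one.trans (one_le_weightV hγ y)))]
          congr 1
          ring
      _ = _ := by
          rw [← integral_const_mul, ofReal_integral_eq_lintegral_ofReal (hfv.const_mul C)]
          exact Filter.Eventually.of_forall fun y => mul_nonneg hCpos.le
            (mul_nonneg (norm_nonneg _) (zero_le_one.trans (one_le_weightV hγ y)))
  have hprod : Integrable
      (fun p : EuclideanSpace ℝ (Fin d) × EuclideanSpace ℝ (Fin d) => kernelK Φ β p.1 p.2 * f p.2)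
      (volume.prod volume) := by
    refine ⟨hprodm, ?_⟩
    rw [hasFiniteIntegral_iff_enorm, lintegral_prod _ hprodm.enorm]
    exact hprodle.trans_lt ENNReal.ofReal_lt_top
  refine ⟨fun x => ?_, fun x => ⟨hdouble x, ?_⟩, hprod.integral_prod_left, ?_⟩
  · have hb : ∀ y, ‖kernelK Φ β x y‖ ≤ ∫ u, ‖Φ u‖ := fun y => by
      refine (norm_integral_le_integral_norm _).trans (le_of_eq ?_)
      congr with u
      rw [norm_mul, norm_oscFactor, mul_one]
    exact hfi.bdd_mul (hKc.comp (continuous_const.prodMk continuous_id)).aestronglyMeasurable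
      (Filter.Eventually.of_forall hb)
  · rw [integral_integral_swap (f := fun u y => oscFactor β x y u * Φ u * f y) (hdouble x).swap]
    simp only [operatorA, kernelK]
    congr with y
    rw [← integral_mul_const]
    congr with u
    ring
  · have hA : Integrable (operatorA Φ β f) := hprod.integral_prod_left
    rw [integral_norm_eq_lintegral_enorm hA.1]
    refine ENNReal.toReal_le_of_le_ofReal (mul_nonneg hCpos.le (integral_nonneg fun y =>
      mul_nonneg (norm_nonneg _) (zero_le_one.trans (one_le_weightV hγ y)))) ?_
    refine le_trans (lintegral_mono fun x => ?_) hprodle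
    exact enorm_integral_le_lintegral_enorm _
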